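/- **Theorem 1.2.** For $r\ge 1$ and $n\ge 0$ let $\mathbb Z_r\wr\mathfrak S_n$ be the set of $r$-colored permutations of $[n]=\{1,\dots,n\}$, that is, of pairs $w=(\sigma,\varepsilon)$ with $\sigma\in\mathfrak S_n$ and $\varepsilon=(\varepsilon_1,\dots,\varepsilon_n)\in\{0,1,\dots,r-1\}^n$. An index $k\in[n]$ is a descent of $w$ if $\varepsilon_k>\varepsilon_{k+1}$, or $\varepsilon_k=\varepsilon_{k+1}$ and $\sigma(k)>\sigma(k+1)$, where $\sigma(n+1):=n+1$ and $\varepsilon_{n+1}:=0$; let $\mathrm{des}(w)$ be the number of descents of $w$. Put $$A_{n,r}(t)=\sum_{w\in\mathbb Z_r\wr\mathfrak S_n}t^{\mathrm{des}(w)}\quad(A_{0,r}(t)=1),\qquad \widetilde A_{n,r}(t)=\sum_{m=0}^n\binom nm t^{n-m}A_{m,r}(t).$$ A polynomial $f(t)$ is called $\gamma$-positive with center $c/2$, where $c \in \mathbb{N}$, if $f(t)=\sum_{i=0}^{\lfloor c/2\rfloor}\gamma_i\,t^i(1+t)^{c-2i}$ for some nonnegative integers $\gamma_i$. For all integers $n\ge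 1$ and $r\ge 2$ there is a unique pair of polynomials $\widetilde A^+_{n,r}(t),\widetilde A^-_{n,r}(t)\in\mathbb Z[t]$ such that $$\widetilde A_{n,r}(t)=\widetilde A^+_{n,r}(t)+\widetilde A^-_{n,r}(t),$$ where $\widetilde A^+_{n,r}(t)$ is $\gamma$-positive with center $n/2$, and $\widetilde A^-_{n,r}(t)$ is $\gamma$-positive with center $(n+1)/2$ and has zero constant term. Moreover, $\widetilde A^+_{n,r}(t)$ equals the $h$-polynomial $h(\Delta,t)=\sum_{i=0}^n f_{i-1}(\Delta)\,t^i(1-t)^{n-i}$ of the boundary complex $\Delta$ of an $n$-dimensional flag simplicial polytope. Here $f_{i}(\Delta)$ is the number of $i$-dimensional faces of $\Delta$ (with $f_{-1}(\Delta)=1$), and the polytope is called flag if $\Delta$ contains every simplex all of whose vertices and edges lie in $\Delta$. -/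

import Mathlib

open Polynomial

/-- `r`-colored permutations of `n` letters (the elements of the wreath product `ℤ_r ≀ 𝔖_n`):
pairs `(σ, ε)`, where `ε k` is the color of `σ k`.  Positions and values are indexed from `0`. -/
abbrev ColoredPerm (r n : ℕ) : Type := Equiv.Perm (Fin n) × (Fin n → Fin r)

namespace ColoredPerm

/-- The letter at position `k`, with the convention that the position following the last one
carries a letter larger than all the others. -/
def letter {r n : ℕ} (w : ColoredPerm r n) (k : ℕ) : ℕ :=
  if h : k < n then (w.1 ⟨k, h⟩ : ℕ) else n

/-- The color at position `k`, with the convention that the position following the last one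
has color `0`. -/
def color {r n : ℕ} (w : ColoredPerm r n) (k : ℕ) : ℕ :=
  if h : k < n then (w.2 ⟨k, h⟩ : ℕ) else 0

/-- The number of descents of a colored permutation. -/
def des {r n : ℕ} (w : ColoredPerm r n) : ℕ :=
  ((Finset.range n).filter fun k =>
    w.color (k + 1) < w.color k ∨
      (w.color k = w.color (k + 1) ∧ w.letter (k + 1) < w.letter k)).card

end ColoredPerm

/-- The Eulerian polynomial `A_{n,r}(t)` of `ℤ_r ≀ 𝔖_n`. -/
noncomputable def coloredEulerian (n r : ℕ) : ℤ[X] :=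
  ∑ w : ColoredPerm r n, X ^ w.des

/-- The colored binomial Eulerian polynomial `Ã_{n,r}(t)`. -/
noncomputable def coloredBinomialEulerian (n r : ℕ) : ℤ[X] :=
  ∑ m ∈ Finset.range (n + 1), (n.choose m : ℤ[X]) * X ^ (n - m) * coloredEulerian m r

/-- `f` is `γ`-positive with center (of symmetry) `c / 2`. -/
def IsGammaPositive (c : ℕ) (f : ℤ[X]) : Prop :=
  ∃ γ : ℕ → ℕ, f = ∑ i ∈ Finset.range (c / 2 + 1), (γ i : ℤ[X]) * X ^ i * (1 + X) ^ (c - 2 * i)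

/-- `(p, q)` is a decomposition of `f` as a sum of a `γ`-positive polynomial with center `n / 2`
and a `γ`-positive polynomial with center `(n + 1) / 2` and zero constant term. -/
structure IsGammaDecomposition (n : ℕ) (f p q : ℤ[X]) : Prop where
  sum_eq : f = p + q
  left : IsGammaPositive n p
  right : IsGammaPositive (n + 1) q
  right_const : q.coeff 0 = 0

namespace PreAbstractSimplicialComplex

variable {ι : Type*}

/-- The `h`-polynomial `∑_{i=0}^d f_{i-1} t^i (1-t)^{d-i}` of a finite simplicial complex of
dimension `d - 1`.  The faces in Mathlib's sense are nonempty, so that the term of the empty face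
(`f_{-1} = 1`) is written separately. -/
noncomputable def hPolynomial (K : PreAbstractSimplicialComplex ι) (d : ℕ) : ℤ[X] :=
  (1 - X) ^ d + ∑ i ∈ Finset.Icc 1 d,
    ({s : Finset ι | s ∈ K ∧ s.card = i}.ncard : ℤ[X]) * X ^ i * (1 - X) ^ (d - i)

/-- A simplicial complex is flag if it contains every (nonempty) simplex whose one-dimensional
skeleton, that is, all of its vertices and edges, lies in the complex. -/
def IsFlag (K : PreAbstractSimplicialComplex ι) : Prop :=
  ∀ s : Finset ι, s.Nonempty →
    (∀ e : Finset ι, e ⊆ s → e.Nonempty → e.card ≤ 2 → e ∈ K) → s ∈ K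

end PreAbstractSimplicialComplex

section Polytope

variable {E : Type*} [NormedAddCommGroup E] [NormedSpace ℝ E]

/-- `P` is a simplicial polytope of dimension `n`: the convex hull of a nonempty finite set of
points, with affine hull of dimension `n`, all of whose proper faces are simplices.  The faces of a
polytope are its exposed subsets, its vertices are its extreme points, and the vertices of a face
are the vertices of the polytope that lie in it. -/
structure IsSimplicialPolytope (n : ℕ) (P : Set E) : Prop where
  isPolytope : ∃ s : Finset E, s.Nonempty ∧ P = convexHull ℝ (s : Set E)
  dim_eq : Module.finrank ℝ (vectorSpan ℝ P) = n
  simplicial : ∀ F : Set E, IsExposed ℝ P F → F ≠ P →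
    AffineIndependent ℝ ((↑) : ↥(F ∩ P.extremePoints ℝ) → E)

/-- The boundary complex of a simplicial polytope `P`, as an abstract simplicial complex on the
vertices of `P`: the nonempty sets of vertices that are contained in a proper face of `P`.  As the
proper faces are simplices, and every face of a face of `P` is a face of `P`, these are precisely
the vertex sets of the nonempty proper faces of `P`. -/
def boundaryComplex (P : Set E) : PreAbstractSimplicialComplex E where
  faces := {s | s.Nonempty ∧
    ∃ F : Set E, IsExposed ℝ P F ∧ F ≠ P ∧ (s : Set E) ⊆ F ∩ P.extremePoints ℝ}
  isRelLowerSet_faces := by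
    rintro s ⟨hs, F, hF, hne, hsub⟩
    exact ⟨hs, fun t hts ht => ⟨ht, F, hF, hne, (Finset.coe_subset.2 hts).trans hsub⟩⟩

end Polytope

/-! The polytope comes from a regular triangulation. The part `max x = r` of the boundary of the
cube `[0, r]^n` is cut into Kuhn simplices (chains of lattice points with `p ≤ q ≤ p + 1`). Coning
from the origin covers the nonnegative orthant, and the rays `-e_i` complete the fan, `-e_i` being
compatible with the points whose coordinate `i` is zero. The cones are the cliques of a graph, which
makes the complex flag. The discretely convex `energy`, raised by a large constant, provides
positive heights `φ` such that every clique is tight for some linear functional below `φ`, and every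
tight set is a clique (`exists_supporting_coeffs`, `compat_of_tight`). The hull of the points `v / φ
v` is then the polytope (`exists_isCliqueRealization`).

Its `h`-polynomial is found by counting lattice vectors. A vector with maximal coordinate `j * r` is
in exactly one way a sum of `j` points of a common Kuhn cell (`combination_injOn`,
`exists_combination_eq`), and the choices of the `-e_i` sum out by the binomial theorem. This gives
`h = t^n + ∑_j t^j ((1 + j r (1 - t))^n - (t + j r (1 - t))^n)`, see `toSeries_sum_chains`.

Inserting the largest letter yields the Carlitz identity `A_{n,r}(t) / (1 - t)^(n+1) = ∑_j (r j +
1)^n t^j`. In exponential generating functions everything becomes closed. Let `s = r - 1`, `T_a =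
(e^{ax} - e^{atx}) / (e^{atx} - t e^{ax})` and `B = (1 - t) e^{(1+t)x} / (e^{tx} - t e^x)`. The
series of the `h`-polynomials is `P = B / (1 - t T_1 T_s)`, and that of the binomial Eulerian
polynomials is `P (1 + t T_s)`. Each of `T_a`, `B` and `1 / (1 - t T_1 T_s)` solves a differential
equation whose right-hand side preserves `γ`-positivity, so the coefficients of `P` and `t T_s P`
are `γ`-positive with centers `n / 2` and `(n + 1) / 2`. Uniqueness holds because a polynomial that
is palindromic about two consecutive centers vanishes. -/

/-! ### Polytopes whose boundary complex is a clique complex. -/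

/-- A realization of the clique complex of a graph `G` by points `u v` on the boundary of their
convex hull: cliques are linearly independent, every clique lies on a hyperplane `ℓ = 1` with all
points on the side `ℓ ≤ 1`, all vertices on such a hyperplane are pairwise adjacent, and the points
positively span the space. -/
structure IsCliqueRealization {V E : Type*} [AddCommGroup E] [Module ℝ E]
    (G : SimpleGraph V) (u : V → E) : Prop where
  indep : ∀ s : Finset V, G.IsClique (s : Set V) → s.Nonempty →
    ∃ v ∈ s, ∃ f : E →ₗ[ℝ] ℝ, f (u v) ≠ 0 ∧ ∀ w ∈ s, w ≠ v → f (u w) = 0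
  support : ∀ s : Finset V, G.IsClique (s : Set V) →
    ∃ l : E →ₗ[ℝ] ℝ, (∀ v, l (u v) ≤ 1) ∧ ∀ v ∈ s, l (u v) = 1
  adj : ∀ l : E →ₗ[ℝ] ℝ, (∀ v, l (u v) ≤ 1) →
    ∀ v w, l (u v) = 1 → l (u w) = 1 → v ≠ w → G.Adj v w
  spanning : ∀ l : E →ₗ[ℝ] ℝ, (∀ v, l (u v) ≤ 0) → l = 0

namespace IsCliqueRealization

section LinearAlgebra

variable {V E : Type*} [AddCommGroup E] [Module ℝ E] {G : SimpleGraph V} {u : V → E}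

/-- Each clique has a vertex `v` and a functional that kills all its other vertices but not `v`;
hence `u v` is outside their span, and `v` can be removed inductively. -/
theorem linearIndepOn (h : IsCliqueRealization G u) (s : Finset V)
    (hs : G.IsClique (s : Set V)) : LinearIndepOn ℝ u (s : Set V) := by
  classical
  induction s using Finset.strongInduction with
  | H s ih =>
    rcases s.eq_empty_or_nonempty with rfl | hne
    · simp [linearIndepOn_empty]
    obtain ⟨v, hv, f, hfv, hf⟩ := h.indep s hs hne
    have h1 := ih (s.erase v) (Finset.erase_ssubset hv)
      (hs.subset (by simp))
    have h2 : u v ∉ Submodule.span ℝ (u '' ((s.erase v : Finset V) : Set V)) := by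
      intro hmem
      have hle : Submodule.span ℝ (u '' ((s.erase v : Finset V) : Set V)) ≤ LinearMap.ker f := by
        rw [Submodule.span_le]
        rintro _ ⟨w, hw, rfl⟩
        have hw' := Finset.mem_erase.1 (Finset.mem_coe.1 hw)
        exact hf w hw'.2 hw'.1
      exact hfv (hle hmem)
    have h3 := h1.insert h2
    rwa [← Finset.coe_insert, Finset.insert_erase hv] at h3

theorem exists_dual (h : IsCliqueRealization G u) (s : Finset V)
    (hs : G.IsClique (s : Set V)) {v : V} (hv : v ∈ s) :
    ∃ f : E →ₗ[ℝ] ℝ, f (u v) = 1 ∧ ∀ w ∈ s, w ≠ v → f (u w) = 0 := by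
  have h1 := h.linearIndepOn s hs
  have h3 : u v ∉ Submodule.span ℝ (u '' ((s : Set V) \ {v})) := by
    exact linearIndepOn_iff_notMem_span.1 h1 v hv
  obtain ⟨f, hfv, hf⟩ := Submodule.exists_le_ker_of_notMem h3
  refine ⟨(f (u v))⁻¹ • f, by simp [hfv], fun w hw hwv => ?_⟩
  have : f (u w) = 0 := hf (Submodule.subset_span ⟨w, ⟨hw, hwv⟩, rfl⟩)
  simp [this]

theorem injective (h : IsCliqueRealization G u) : Function.Injective u := by
  classical
  intro v w hvw
  by_contra hne
  obtain ⟨l, hl, hlv⟩ := h.support {v} (by simp)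
  have h1 := hlv v (by simp)
  have hadj := h.adj l hl v w h1 (hvw ▸ h1) hne
  have hc : G.IsClique (({v, w} : Finset V) : Set V) := by
    simp [SimpleGraph.isClique_insert, hadj]
  obtain ⟨f, hf1, hf2⟩ := h.exists_dual {v, w} hc (v := v) (by simp)
  have := hf2 w (by simp) (Ne.symm hne)
  rw [← hvw, hf1] at this
  exact one_ne_zero this

theorem isClique_of_tight (h : IsCliqueRealization G u) {l : E →ₗ[ℝ] ℝ}
    (hl : ∀ v, l (u v) ≤ 1) (s : Finset V) (hs : ∀ v ∈ s, l (u v) = 1) :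
    G.IsClique (s : Set V) :=
  fun v hv w hw hne => h.adj l hl v w (hs v hv) (hs w hw) hne

/-- Tilt a supporting functional at `v` by a small multiple of the dual functional `g` of `v` in the
clique of tight vertices. The other tight vertices have `g = 0` and fall behind `v`; the slack ones
stay slack for small `ε`. -/
theorem exists_strict_support [Finite V] (h : IsCliqueRealization G u) (v : V) :
    ∃ l : E →ₗ[ℝ] ℝ, l (u v) = 1 ∧ ∀ w, w ≠ v → l (u w) < 1 := by
  classical
  have := Fintype.ofFinite V
  obtain ⟨l, hl, hlv⟩ := h.support {v} (by simp)
  have hv : l (u v) = 1 := hlv v (by simp)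
  set T : Finset V := Finset.univ.filter fun w => l (u w) = 1 with hT
  have hTc : G.IsClique (T : Set V) := h.isClique_of_tight hl T (by simp [hT])
  obtain ⟨g, hg1, hg2⟩ := h.exists_dual T hTc (v := v) (by simp [hT, hv])
  have hev : ∀ᶠ ε : ℝ in nhdsWithin 0 (Set.Ioi 0),
      ∀ w, w ≠ v → l (u w) + ε * (g (u w) - 1) < 1 := by
    rw [Filter.eventually_all]
    intro w
    by_cases hwv : w = v
    · simp [hwv]
    by_cases hw : l (u w) = 1
    · have : g (u w) = 0 := hg2 w (by simp [hT, hw]) hwv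
      filter_upwards [self_mem_nhdsWithin] with ε hε _
      have : 0 < ε := hε
      rw [hw, hg2 w (by simp [hT, hw]) hwv]
      linarith
    · have hlt : l (u w) < 1 := lt_of_le_of_ne (hl w) hw
      have hc : Filter.Tendsto (fun ε : ℝ => l (u w) + ε * (g (u w) - 1)) (nhds 0)
          (nhds (l (u w) + 0 * (g (u w) - 1))) :=
        (Continuous.tendsto (by fun_prop) 0)
      rw [zero_mul, add_zero] at hc
      exact ((hc.mono_left nhdsWithin_le_nhds).eventually (gt_mem_nhds hlt)).mono
        fun ε hε _ => hε
  obtain ⟨ε, hε, hpos⟩ := (hev.and self_mem_nhdsWithin).exists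
  have hpos' : (0 : ℝ) < ε := hpos
  -- The factor restores the value `1` at `u v`, where `l + ε • g` equals `1 + ε`.
  refine ⟨(1 + ε)⁻¹ • (l + ε • g), ?_, fun w hw => ?_⟩
  · simp only [LinearMap.smul_apply, LinearMap.add_apply, smul_eq_mul, hv, hg1, mul_one]
    field_simp
  · have := hε w hw
    simp only [LinearMap.smul_apply, LinearMap.add_apply, smul_eq_mul]
    rw [inv_mul_lt_iff₀ (by linarith)]
    linarith

theorem le_of_mem_convexHull {l : E →ₗ[ℝ] ℝ} {c : ℝ} (hl : ∀ v, l (u v) ≤ c) {x : E}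
    (hx : x ∈ convexHull ℝ (Set.range u)) : l x ≤ c := by
  have : convexHull ℝ (Set.range u) ⊆ {y | l y ≤ c} :=
    convexHull_min (by rintro _ ⟨v, rfl⟩; exact hl v) (convex_halfSpace_le l.isLinear c)
  exact this hx

theorem mem_extremePoints [Finite V] (h : IsCliqueRealization G u) (v : V) :
    u v ∈ (convexHull ℝ (Set.range u)).extremePoints ℝ := by
  obtain ⟨l, hl1, hl2⟩ := h.exists_strict_support v
  -- The half-space `l ≤ 1` stripped of every point of its boundary hyperplane except `u v` is still
  -- convex.
  have hsub : convexHull ℝ (Set.range u) ⊆ {y | l y ≤ 1 ∧ (l y = 1 → y = u v)} := by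
    refine convexHull_min ?_ ?_
    · rintro _ ⟨w, rfl⟩
      by_cases hw : w = v
      · subst hw; exact ⟨hl1.le, fun _ => rfl⟩
      · exact ⟨(hl2 w hw).le, fun h1 => absurd h1 (hl2 w hw).ne⟩
    · rw [convex_iff_forall_pos]
      rintro x ⟨hx1, hx2⟩ y ⟨hy1, hy2⟩ a b ha hb hab
      simp only [Set.mem_ofPred_eq, map_add, map_smul, smul_eq_mul]
      refine ⟨by nlinarith, fun hone => ?_⟩
      have hx : l x = 1 := by
        by_contra hne
        have : l x < 1 := lt_of_le_of_ne hx1 hne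
        nlinarith
      have hy : l y = 1 := by
        by_contra hne
        have : l y < 1 := lt_of_le_of_ne hy1 hne
        nlinarith
      rw [hx2 hx, hy2 hy, ← add_smul, hab, one_smul]
  rw [mem_extremePoints_iff_left]
  refine ⟨subset_convexHull ℝ _ ⟨v, rfl⟩, ?_⟩
  intro x hx y hy hv
  obtain ⟨a, b, ha, hb, hab, hab'⟩ := hv
  have h1 := hsub hx
  have h2 := hsub hy
  apply h1.2
  by_contra hne
  have hlt : l x < 1 := lt_of_le_of_ne h1.1 hne
  have : l (a • x + b • y) = 1 := by rw [hab', hl1]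
  simp only [map_add, map_smul, smul_eq_mul] at this
  have := h2.1
  nlinarith

theorem extremePoints_eq [Finite V] (h : IsCliqueRealization G u) :
    (convexHull ℝ (Set.range u)).extremePoints ℝ = Set.range u := by
  apply Set.Subset.antisymm extremePoints_convexHull_subset
  rintro _ ⟨v, rfl⟩
  exact h.mem_extremePoints v

theorem card_le_finrank [FiniteDimensional ℝ E] (h : IsCliqueRealization G u) (s : Finset V)
    (hs : G.IsClique (s : Set V)) : s.card ≤ Module.finrank ℝ E := by
  have h1 : LinearIndependent ℝ (fun v : (s : Set V) => u v) := h.linearIndepOn s hs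
  have := h1.fintype_card_le_finrank
  simpa using this

/-- A functional vanishing on all differences is constant on the vertices, so it or its negative is
nonpositive there; positive spanning makes it zero. -/
theorem vectorSpan_eq_top [Nonempty V] (h : IsCliqueRealization G u) :
    vectorSpan ℝ (convexHull ℝ (Set.range u)) = ⊤ := by
  by_contra hne
  obtain ⟨f, hf0, hf⟩ := Submodule.exists_le_ker_of_lt_top _ (lt_top_iff_ne_top.2 hne)
  obtain ⟨v₀⟩ := ‹Nonempty V›
  have hconst : ∀ v, f (u v) = f (u v₀) := fun v => by
    have := hf (vsub_mem_vectorSpan ℝ (subset_convexHull ℝ _ ⟨v, rfl⟩ : u v ∈ convexHull ℝ (Set.range u))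
      (subset_convexHull ℝ _ ⟨v₀, rfl⟩ : u v₀ ∈ convexHull ℝ (Set.range u)))
    simpa [sub_eq_zero] using this
  rcases le_total (f (u v₀)) 0 with hle | hle
  · exact hf0 (h.spanning f fun v => (hconst v).trans_le hle)
  · refine hf0 (neg_eq_zero.1 (h.spanning (-f) fun v => ?_))
    rw [LinearMap.neg_apply, hconst]
    linarith

end LinearAlgebra

section Faces

variable {V E : Type*} [NormedAddCommGroup E] [NormedSpace ℝ E] {G : SimpleGraph V} {u : V → E}

/-- Proper exposed faces are cut out by supporting functionals normalized to `1`. -/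
theorem exists_functional_of_isExposed (h : IsCliqueRealization G u) {F : Set E}
    (hF : IsExposed ℝ (convexHull ℝ (Set.range u)) F)
    (hne : F ≠ convexHull ℝ (Set.range u)) (hFn : F.Nonempty) :
    ∃ l : E →ₗ[ℝ] ℝ, (∀ v, l (u v) ≤ 1) ∧ ∀ x ∈ F, l x = 1 := by
  obtain ⟨l, rfl⟩ := hF hFn
  obtain ⟨x, hx, hmax⟩ := hFn
  -- A nonpositive maximum would force `l = 0` by `spanning`, and the face would be the whole
  -- polytope.
  have hpos : 0 < l x := by
    by_contra hle
    have hl0 : (l : E →ₗ[ℝ] ℝ) = 0 := h.spanning _ fun v =>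
      (hmax (u v) (subset_convexHull ℝ _ ⟨v, rfl⟩)).trans (not_lt.1 hle)
    apply hne
    ext y
    have hz : ∀ z, l z = 0 := fun z => by
      have := congrArg (fun f : E →ₗ[ℝ] ℝ => f z) hl0
      simpa using this
    simp [hz]
  refine ⟨(l x)⁻¹ • (l : E →ₗ[ℝ] ℝ), fun v => ?_, fun y hy => ?_⟩
  · have := hmax (u v) (subset_convexHull ℝ _ ⟨v, rfl⟩)
    simp only [LinearMap.smul_apply, smul_eq_mul, ContinuousLinearMap.coe_coe]
    rw [inv_mul_le_iff₀ hpos]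
    linarith
  · have h1 := hmax y hy.1
    have h2 := hy.2 x hx
    simp only [LinearMap.smul_apply, smul_eq_mul, ContinuousLinearMap.coe_coe]
    rw [le_antisymm h1 h2]
    field_simp

/-- The vertices of a proper face are tight for one functional, hence form a clique; they are even
linearly independent. -/
theorem isSimplicialPolytope [Fintype V] [Nonempty V] (h : IsCliqueRealization G u) :
    IsSimplicialPolytope (Module.finrank ℝ E) (convexHull ℝ (Set.range u)) := by
  classical
  refine ⟨⟨Finset.univ.image u, by simp, by simp⟩, ?_, ?_⟩
  · rw [h.vectorSpan_eq_top, finrank_top]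
  · intro F hF hne
    rcases F.eq_empty_or_nonempty with rfl | hFn
    · have : IsEmpty ↥((∅ : Set E) ∩ (convexHull ℝ (Set.range u)).extremePoints ℝ) := by
        rw [Set.empty_inter]; infer_instance
      exact affineIndependent_of_subsingleton ℝ _
    obtain ⟨l, hl, hlF⟩ := h.exists_functional_of_isExposed hF hne hFn
    let T : Finset V := Finset.univ.filter fun v => l (u v) = 1
    have hT := (h.linearIndepOn T (h.isClique_of_tight hl T (by simp [T]))).id_image
    have hsub : F ∩ (convexHull ℝ (Set.range u)).extremePoints ℝ ⊆ u '' (T : Set V) := by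
      rintro x ⟨hx, hx'⟩
      rw [h.extremePoints_eq] at hx'
      obtain ⟨v, rfl⟩ := hx'
      exact ⟨v, by simpa [T] using hlF _ hx, rfl⟩
    have h1 : LinearIndependent ℝ
        ((↑) : ↥(F ∩ (convexHull ℝ (Set.range u)).extremePoints ℝ) → E) := hT.mono hsub
    exact h1.affineIndependent

end Faces

section Polytope

variable {V E : Type*} [NormedAddCommGroup E] [NormedSpace ℝ E]
  [FiniteDimensional ℝ E] {G : SimpleGraph V} {u : V → E}

/-- Every clique lies on a proper exposed face. -/
theorem exists_isExposed (h : IsCliqueRealization G u) (s : Finset V)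
    (hs : G.IsClique (s : Set V)) (hsn : s.Nonempty) :
    ∃ F, IsExposed ℝ (convexHull ℝ (Set.range u)) F ∧ F ≠ convexHull ℝ (Set.range u) ∧
      ∀ v ∈ s, u v ∈ F := by
  obtain ⟨l, hl, hls⟩ := h.support s hs
  let L := l.toContinuousLinearMap
  refine ⟨L.toExposed (convexHull ℝ (Set.range u)), ContinuousLinearMap.toExposed.isExposed, ?_, ?_⟩
  -- If the face were everything, `-l` would be at most `-1` on all vertices, so `l = 0`, against `l
  -- (u v) = 1`.
  · intro heq
    obtain ⟨v, hv⟩ := hsn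
    have hge : ∀ w, 1 ≤ l (u w) := fun w => by
      have hw : u w ∈ L.toExposed (convexHull ℝ (Set.range u)) :=
        by rw [heq]; exact subset_convexHull ℝ _ (Set.mem_range_self w)
      rw [← hls v hv]
      exact hw.2 (u v) (subset_convexHull ℝ _ ⟨v, rfl⟩)
    have h0 := h.spanning (-l) fun w => by
      have := hge w
      simp only [LinearMap.neg_apply]
      linarith
    have h1 := hls v hv
    rw [neg_eq_zero.1 h0] at h1
    simp at h1
  · intro v hv
    refine ⟨subset_convexHull ℝ _ ⟨v, rfl⟩, fun y hy => ?_⟩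
    change l y ≤ l (u v)
    rw [hls v hv]
    exact le_of_mem_convexHull hl hy

variable [Fintype V]

theorem mem_boundaryComplex_iff (h : IsCliqueRealization G u) [DecidableEq E] (t : Finset E) :
    t ∈ boundaryComplex (convexHull ℝ (Set.range u)) ↔
      t.Nonempty ∧ ∃ s : Finset V, G.IsClique (s : Set V) ∧ t = s.image u := by
  classical
  constructor
  · rintro ⟨htn, F, hF, hne, hsub⟩
    refine ⟨htn, ?_⟩
    obtain ⟨x, hx⟩ := htn
    obtain ⟨l, hl, hlF⟩ := h.exists_functional_of_isExposed hF hne ⟨x, (hsub hx).1⟩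
    refine ⟨Finset.univ.filter fun v => u v ∈ t, ?_, ?_⟩
    · apply h.isClique_of_tight hl
      intro v hv
      exact hlF _ (hsub (Finset.mem_filter.1 hv).2).1
    · ext y
      simp only [Finset.mem_image, Finset.mem_filter, Finset.mem_univ, true_and]
      constructor
      · intro hy
        have := (hsub hy).2
        rw [h.extremePoints_eq] at this
        obtain ⟨v, rfl⟩ := this
        exact ⟨v, hy, rfl⟩
      · rintro ⟨v, hv, rfl⟩
        exact hv
  · rintro ⟨htn, s, hs, rfl⟩
    obtain ⟨F, hF, hne, hsF⟩ := h.exists_isExposed s hs (Finset.image_nonempty.1 htn)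
    refine ⟨htn, F, hF, hne, ?_⟩
    intro y hy
    obtain ⟨v, hv, rfl⟩ := Finset.mem_image.1 (Finset.mem_coe.1 hy)
    exact ⟨hsF v hv, h.mem_extremePoints v⟩

/-- Being a clique is a condition on pairs, and an edge of the complex is the image of a clique, so
its ends are adjacent. -/
theorem isFlag_boundaryComplex (h : IsCliqueRealization G u) :
    (boundaryComplex (convexHull ℝ (Set.range u))).IsFlag := by
  classical
  intro t htn ht
  rw [h.mem_boundaryComplex_iff]
  refine ⟨htn, Finset.univ.filter fun v => u v ∈ t, ?_, ?_⟩
  · intro v hv w hw hvw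
    simp only [Finset.coe_filter, Finset.mem_univ, true_and, Set.mem_ofPred_eq] at hv hw
    have h1 := ht {u v, u w} (by
      intro x hx
      rcases Finset.mem_insert.1 hx with rfl | hx
      · exact hv
      · rw [Finset.mem_singleton.1 hx]; exact hw) (by simp) Finset.card_le_two
    rw [h.mem_boundaryComplex_iff] at h1
    obtain ⟨-, s, hs, hst⟩ := h1
    have hmem : ∀ z, u z ∈ ({u v, u w} : Finset E) → z ∈ s := fun z hz => by
      rw [hst] at hz
      obtain ⟨z', hz', hzz⟩ := Finset.mem_image.1 hz
      rwa [← h.injective hzz]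
    exact hs (hmem v (by simp)) (hmem w (by simp)) hvw
  · ext y
    simp only [Finset.mem_image, Finset.mem_filter, Finset.mem_univ, true_and]
    constructor
    · intro hy
      have h1 := ht {y} (by simpa using hy) (by simp) (by simp)
      rw [h.mem_boundaryComplex_iff] at h1
      obtain ⟨-, s, -, hst⟩ := h1
      have : y ∈ s.image u := hst ▸ Finset.mem_singleton_self y
      obtain ⟨v, -, rfl⟩ := Finset.mem_image.1 this
      exact ⟨v, hy, rfl⟩
    · rintro ⟨v, hv, rfl⟩
      exact hv

open Classical in
-- Injectivity of `u` matches faces with cliques of the same size, `card_le_finrank` leaves no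
-- clique out of the range of summation, and the empty clique accounts for the separate term `(1 -
-- X) ^ d`.
theorem hPolynomial_eq (h : IsCliqueRealization G u) :
    (boundaryComplex (convexHull ℝ (Set.range u))).hPolynomial (Module.finrank ℝ E) =
      ∑ s ∈ (Finset.univ : Finset (Finset V)).filter (fun s : Finset V => G.IsClique (s : Set V)),
        X ^ s.card * (1 - X) ^ (Module.finrank ℝ E - s.card) := by
  set d := Module.finrank ℝ E
  have hcard : ∀ i ∈ Finset.Icc 1 d,
      {t : Finset E | t ∈ boundaryComplex (convexHull ℝ (Set.range u)) ∧ t.card = i}.ncard =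
      (((Finset.univ : Finset (Finset V)).filter
        (fun s : Finset V => G.IsClique (s : Set V))).filter fun s : Finset V => s.card = i).card := by
    intro i hi
    rw [← Set.ncard_coe_finset]
    have hinj : Function.Injective (fun s : Finset V => s.image u) :=
      Finset.image_injective h.injective
    rw [← Set.ncard_image_of_injective _ hinj]
    congr 1
    ext t
    simp only [Set.mem_ofPred_eq, h.mem_boundaryComplex_iff, Finset.coe_filter, Finset.mem_filter,
      Finset.mem_univ, true_and, Set.mem_image]
    constructor
    · rintro ⟨⟨-, s, hs, rfl⟩, hc⟩
      rw [Finset.card_image_of_injective _ h.injective] at hc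
      exact ⟨s, ⟨hs, hc⟩, rfl⟩
    · rintro ⟨s, ⟨hs, hc⟩, rfl⟩
      rw [Finset.card_image_of_injective _ h.injective]
      refine ⟨⟨?_, s, hs, rfl⟩, hc⟩
      rw [Finset.image_nonempty, ← Finset.card_pos, hc]
      exact (Finset.mem_Icc.1 hi).1
  have hmaps : ∀ s ∈ (Finset.univ : Finset (Finset V)).filter (fun s : Finset V => G.IsClique (s : Set V)),
      s.card ∈ insert 0 (Finset.Icc 1 d) := by
    intro s hs
    have := h.card_le_finrank s (Finset.mem_filter.1 hs).2
    simp only [Finset.mem_insert, Finset.mem_Icc]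
    omega
  rw [← Finset.sum_fiberwise_of_maps_to hmaps, Finset.sum_insert (by simp)]
  unfold PreAbstractSimplicialComplex.hPolynomial
  congr 1
  · have : ((Finset.univ : Finset (Finset V)).filter
        (fun s : Finset V => G.IsClique (s : Set V))).filter (fun s => s.card = 0) = {∅} := by
      ext s
      simp only [Finset.mem_filter, Finset.mem_univ, true_and, Finset.card_eq_zero,
        Finset.mem_singleton]
      constructor
      · exact fun h => h.2
      · rintro rfl; simp
    rw [this]
    simp
  · refine Finset.sum_congr rfl fun i hi => ?_
    rw [hcard i hi, Finset.sum_congr rfl (g := fun _ => X ^ i * (1 - X) ^ (d - i))]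
    · rw [Finset.sum_const, nsmul_eq_mul, mul_assoc]
    · intro s hs
      rw [(Finset.mem_filter.1 hs).2]

end Polytope

end IsCliqueRealization

/-! ### The Kuhn triangulation and its convex energy. -/

/-- Lattice points of the boundary part `max x = r` of the cube `[0, r]^n`. -/
abbrev CubePoint (n r : ℕ) : Type := {p : Fin n → Fin (r + 1) // ∃ i, (p i : ℕ) = r}

namespace CubePoint

variable {n r : ℕ}

/-- The coordinates of a lattice point. -/
def coord (p : CubePoint n r) (i : Fin n) : ℕ := p.1 i

instance : CoeFun (CubePoint n r) fun _ => Fin n → ℕ := ⟨coord⟩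

theorem exists_coord_eq (p : CubePoint n r) : ∃ i, p i = r := p.2

theorem le (p : CubePoint n r) (i : Fin n) : p i ≤ r := Nat.lt_succ_iff.1 (p.1 i).2

@[ext]
theorem ext {p q : CubePoint n r} (h : ∀ i, p i = q i) : p = q :=
  Subtype.ext (funext fun i => Fin.ext (h i))

/-- The lattice point with prescribed coordinates. -/
def mk' (x : Fin n → ℕ) (hx : ∀ i, x i ≤ r) (hr : ∃ i, x i = r) : CubePoint n r :=
  ⟨fun i => ⟨x i, Nat.lt_succ_iff.2 (hx i)⟩, hr⟩

@[simp]
theorem mk'_apply (x : Fin n → ℕ) (hx : ∀ i, x i ≤ r) (hr : ∃ i, x i = r) (i : Fin n) :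
    mk' x hx hr i = x i := rfl

/-- `p ≤ q ≤ p + 1` coordinatewise. -/
def Step (p q : CubePoint n r) : Prop := ∀ i, p i ≤ q i ∧ q i ≤ p i + 1

/-- Finite sets of lattice points of a common cell of the Kuhn triangulation. -/
def IsChainSet (P : Finset (CubePoint n r)) : Prop := ∀ p ∈ P, ∀ q ∈ P, Step p q ∨ Step q p

theorem IsChainSet.subset {P Q : Finset (CubePoint n r)} (hP : IsChainSet P) (h : Q ⊆ P) :
    IsChainSet Q := fun p hp q hq => hP p (h hp) q (h hq)

theorem IsChainSet.exists_top {P : Finset (CubePoint n r)} (hP : IsChainSet P)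
    (hne : P.Nonempty) : ∃ p ∈ P, ∀ q ∈ P, Step q p := by
  obtain ⟨p, hp, hmax⟩ := Finset.exists_max_image P (fun p => ∑ i, p i) hne
  refine ⟨p, hp, fun q hq => ?_⟩
  rcases hP q hq p hp with h | h
  · exact h
  · have h1 : ∀ i ∈ Finset.univ, p i = q i := (Finset.sum_eq_sum_iff_of_le fun i _ => (h i).1).1
      (le_antisymm (Finset.sum_le_sum fun i _ => (h i).1) (hmax q hq))
    intro i
    have := h1 i (Finset.mem_univ i)
    omega

theorem IsChainSet.exists_bot {P : Finset (CubePoint n r)} (hP : IsChainSet P)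
    (hne : P.Nonempty) : ∃ p ∈ P, ∀ q ∈ P, Step p q := by
  obtain ⟨p, hp, hmin⟩ := Finset.exists_min_image P (fun p => ∑ i, p i) hne
  refine ⟨p, hp, fun q hq => ?_⟩
  rcases hP p hp q hq with h | h
  · exact h
  · have h1 : ∀ i ∈ Finset.univ, q i = p i := (Finset.sum_eq_sum_iff_of_le fun i _ => (h i).1).1
      (le_antisymm (Finset.sum_le_sum fun i _ => (h i).1) (hmin q hq))
    intro i
    have := h1 i (Finset.mem_univ i)
    omega

/-- The lowest point has a coordinate equal to `r`, and every other point lies between it and the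
bound `r`. -/
theorem IsChainSet.exists_common_max {P : Finset (CubePoint n r)} (hP : IsChainSet P)
    (hne : P.Nonempty) : ∃ m, ∀ p ∈ P, p m = r := by
  obtain ⟨p, -, hbot⟩ := hP.exists_bot hne
  obtain ⟨m, hm⟩ := p.exists_coord_eq
  refine ⟨m, fun q hq => le_antisymm (q.le m) ?_⟩
  have := (hbot q hq m).1
  omega

/-- Let `p` be the top point and `q` the next one, with `p i ≠ q i`. Then `p i = q i + 1`, and every
point other than `p` has coordinate `q i` at `i`. At the common maximum `m` all points take the
value `r`, so `x_i - (q i / r) x_m` singles out `p`. -/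
theorem IsChainSet.exists_dual (hr : 0 < r) {P : Finset (CubePoint n r)} (hP : IsChainSet P)
    (hne : P.Nonempty) : ∃ p ∈ P, ∃ a : Fin n → ℝ, ∑ i, a i * p i ≠ 0 ∧
      ∀ q ∈ P, q ≠ p → ∑ i, a i * q i = 0 := by
  classical
  have hr' : (r : ℝ) ≠ 0 := by positivity
  obtain ⟨m, hm⟩ := hP.exists_common_max hne
  obtain ⟨p, hp, htop⟩ := hP.exists_top hne
  refine ⟨p, hp, ?_⟩
  rcases (P.erase p).eq_empty_or_nonempty with he | hne'
  · refine ⟨Pi.single m 1, ?_, fun q hq hqp => ?_⟩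
    · simp [Pi.single_apply, hm p hp, hr.ne']
    · exact absurd (Finset.mem_erase.2 ⟨hqp, hq⟩) (by simp [he])
  obtain ⟨q, hq, htop'⟩ := (hP.subset (Finset.erase_subset p P)).exists_top hne'
  obtain ⟨hqp, hqP⟩ := Finset.mem_erase.1 hq
  obtain ⟨i, hi⟩ : ∃ i, q i ≠ p i := by
    by_contra h
    push Not at h
    exact hqp (CubePoint.ext h)
  have hval : ∀ w : CubePoint n r, w m = r →
      ∑ k, ((Pi.single i 1 : Fin n → ℝ) k - (q i / r : ℝ) * (Pi.single m 1 : Fin n → ℝ) k) * w k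
        = (w i : ℝ) - q i := by
    intro w hw
    simp only [sub_mul, Finset.sum_sub_distrib, mul_assoc, ← Finset.mul_sum]
    simp [Pi.single_apply, hw, hr']
  refine ⟨fun k => (Pi.single i 1 : Fin n → ℝ) k - (q i / r : ℝ) * (Pi.single m 1 : Fin n → ℝ) k,
    ?_, fun w hw hwp => ?_⟩
  · rw [hval p (hm p hp), sub_ne_zero]
    exact_mod_cast (Ne.symm hi)
  · rw [hval w (hm w hw), sub_eq_zero]
    have h1 := htop' w (Finset.mem_erase.2 ⟨hwp, hw⟩) i
    have h2 := htop w hw i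
    have h3 := htop q hqP i
    have : w i = q i := by omega
    exact_mod_cast this

/-- A discretely strictly convex quadratic form. -/
noncomputable def energy (x : Fin n → ℝ) : ℝ := ∑ i, ∑ j, (x i - x j) ^ 2 + ∑ i, x i ^ 2

theorem energy_nonneg (x : Fin n → ℝ) : 0 ≤ energy x := by
  unfold energy
  positivity

/-- The left side is the chord of the parabola over `[c, c + 1]`; no integer lies strictly between
`c` and `c + 1`, so it stays below the parabola at integers. -/
theorem two_mul_add_one_mul_sub_le (c d : ℤ) : (2 * c + 1) * d - c * (c + 1) ≤ d ^ 2 := by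
  have : 0 ≤ (d - c) * (d - c - 1) := by
    rcases le_or_gt d c with h | h
    · nlinarith
    · exact mul_nonneg (by omega) (by omega)
  nlinarith

theorem two_mul_add_one_mul_sub_eq {c d : ℤ} (h1 : c ≤ d) (h2 : d ≤ c + 1) :
    (2 * c + 1) * d - c * (c + 1) = d ^ 2 := by
  obtain rfl | rfl : d = c ∨ d = c + 1 := by omega
  all_goals ring

/-- On a cell of the Kuhn triangulation the energy agrees with an affine minorant. -/
theorem IsChainSet.exists_affine_minorant {P : Finset (CubePoint n r)} (hP : IsChainSet P)
    (hne : P.Nonempty) : ∃ (C : ℝ) (L : (Fin n → ℝ) →ₗ[ℝ] ℝ),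
      (∀ p : CubePoint n r, L (fun i => p i) ≤ energy (fun i => (p i : ℝ)) + C) ∧
      ∀ p ∈ P, L (fun i => p i) = energy (fun i => (p i : ℝ)) + C := by
  have hc : ∀ f : CubePoint n r → ℤ, (∀ p ∈ P, ∀ q ∈ P, f q ≤ f p + 1) →
      ∃ c : ℤ, ∀ p ∈ P, c ≤ f p ∧ f p ≤ c + 1 := by
    intro f hf
    obtain ⟨q, hq, hmin⟩ := Finset.exists_min_image P f hne
    exact ⟨f q, fun p hp => ⟨hmin p hp, hf q hq p hp⟩⟩
  -- On a chain set each coordinate, and each difference of coordinates, takes at most two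
  -- consecutive values. Replacing every square in the energy by its chord over these values gives
  -- the minorant.
  have h1 : ∀ i j, ∃ c : ℤ, ∀ p ∈ P, c ≤ (p i : ℤ) - p j ∧ (p i : ℤ) - p j ≤ c + 1 := by
    intro i j
    refine hc (fun p => (p i : ℤ) - p j) fun p hp q hq => ?_
    rcases hP p hp q hq with h | h
    · have := h i; have := h j; omega
    · have := h i; have := h j; omega
  have h2 : ∀ i, ∃ c : ℤ, ∀ p ∈ P, c ≤ (p i : ℤ) ∧ (p i : ℤ) ≤ c + 1 := by
    intro i
    refine hc (fun p => (p i : ℤ)) fun p hp q hq => ?_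
    rcases hP p hp q hq with h | h
    · have := h i; omega
    · have := h i; omega
  choose c hc using h1
  choose d hd using h2
  refine ⟨∑ i, ∑ j, (c i j : ℝ) * (c i j + 1) + ∑ i, (d i : ℝ) * (d i + 1),
    ∑ i, ∑ j, (2 * (c i j : ℝ) + 1) • (LinearMap.proj (R := ℝ) (φ := fun _ => ℝ) i -
      LinearMap.proj (R := ℝ) (φ := fun _ => ℝ) j) +
      ∑ i, (2 * (d i : ℝ) + 1) • LinearMap.proj (R := ℝ) (φ := fun _ => ℝ) i, ?_, ?_⟩
  · intro p
    simp only [LinearMap.add_apply, LinearMap.sum_apply, LinearMap.smul_apply, LinearMap.sub_apply,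
      LinearMap.proj_apply, smul_eq_mul, energy]
    have e1 : ∀ i j, (2 * (c i j : ℝ) + 1) * ((p i : ℝ) - p j) ≤
        ((p i : ℝ) - p j) ^ 2 + (c i j : ℝ) * (c i j + 1) := by
      intro i j
      have := two_mul_add_one_mul_sub_le (c i j) ((p i : ℤ) - p j)
      rw [sub_le_iff_le_add] at this
      exact_mod_cast this
    have e2 : ∀ i, (2 * (d i : ℝ) + 1) * (p i : ℝ) ≤ (p i : ℝ) ^ 2 + (d i : ℝ) * (d i + 1) := by
      intro i
      have := two_mul_add_one_mul_sub_le (d i) (p i : ℤ)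
      rw [sub_le_iff_le_add] at this
      exact_mod_cast this
    have s1 := Finset.sum_le_sum fun i (_ : i ∈ Finset.univ) =>
      Finset.sum_le_sum fun j (_ : j ∈ Finset.univ) => e1 i j
    have s2 := Finset.sum_le_sum fun i (_ : i ∈ Finset.univ) => e2 i
    simp only [Finset.sum_add_distrib] at s1 s2
    linarith
  · intro p hp
    simp only [LinearMap.add_apply, LinearMap.sum_apply, LinearMap.smul_apply, LinearMap.sub_apply,
      LinearMap.proj_apply, smul_eq_mul, energy]
    have e1 : ∀ i j, (2 * (c i j : ℝ) + 1) * ((p i : ℝ) - p j) =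
        ((p i : ℝ) - p j) ^ 2 + (c i j : ℝ) * (c i j + 1) := by
      intro i j
      have := two_mul_add_one_mul_sub_eq (hc i j p hp).1 (hc i j p hp).2
      rw [sub_eq_iff_eq_add] at this
      exact_mod_cast this
    have e2 : ∀ i, (2 * (d i : ℝ) + 1) * (p i : ℝ) = (p i : ℝ) ^ 2 + (d i : ℝ) * (d i + 1) := by
      intro i
      have := two_mul_add_one_mul_sub_eq (hd i p hp).1 (hd i p hp).2
      rw [sub_eq_iff_eq_add] at this
      exact_mod_cast this
    simp only [e1, e2, Finset.sum_add_distrib]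
    ring

/-- For a fixed sum, the sum of squares is governed by the difference, whose parity is also fixed;
the balanced pair is therefore minimal, and only balanced pairs attain the minimum. -/
theorem sq_add_sq_half (x y u v : ℤ) (hs : u + v = x + y) (hd : |u - v| ≤ 1) :
    u ^ 2 + v ^ 2 ≤ x ^ 2 + y ^ 2 ∧ (u ^ 2 + v ^ 2 = x ^ 2 + y ^ 2 → |x - y| ≤ 1) := by
  have h1 : 2 * (u ^ 2 + v ^ 2) = (x + y) ^ 2 + (u - v) ^ 2 := by rw [← hs]; ring
  have h2 : 2 * (x ^ 2 + y ^ 2) = (x + y) ^ 2 + (x - y) ^ 2 := by ring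
  have h3 : (u - v) ^ 2 ≤ 1 := by rw [← sq_abs]; nlinarith [abs_nonneg (u - v)]
  by_cases hxy : |x - y| ≤ 1
  · refine ⟨?_, fun _ => hxy⟩
    rw [abs_le] at hd hxy
    have : (u - v) ^ 2 = (x - y) ^ 2 := by
      obtain h | h | h : u - v = -1 ∨ u - v = 0 ∨ u - v = 1 := by omega
      · obtain h' | h' : x - y = 1 ∨ x - y = -1 := by omega
        all_goals simp [h, h']
      · have h' : x - y = 0 := by omega
        rw [h, h']
      · obtain h' | h' : x - y = 1 ∨ x - y = -1 := by omega
        all_goals simp [h, h']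
    linarith
  · have h4 : 4 ≤ (x - y) ^ 2 := by rw [← sq_abs]; nlinarith
    exact ⟨by linarith, fun h => by linarith⟩

/-- Discrete midpoint convexity of the energy; equality holds only inside a Kuhn cell. -/
theorem step_of_energy_le (p q : CubePoint n r)
    (h : energy (fun i => (p i : ℝ)) + energy (fun i => (q i : ℝ)) ≤
      energy (fun i => (((p i + q i) / 2 : ℕ) : ℝ)) +
        energy (fun i => (((p i + q i + 1) / 2 : ℕ) : ℝ))) :
    Step p q ∨ Step q p := by
  -- The rounded midpoints `a` and `b` add up to `p + q`, and both their coordinates and their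
  -- coordinate differences are balanced. So `sq_add_sq_half` applies to every square in the energy,
  -- and the hypothesis forces equality in each.
  set a : Fin n → ℤ := fun i => ((p i + q i) / 2 : ℕ) with ha
  set b : Fin n → ℤ := fun i => ((p i + q i + 1) / 2 : ℕ) with hb
  have hab : ∀ i, a i + b i = (p i : ℤ) + q i := fun i => by simp only [ha, hb]; omega
  have hab1 : ∀ i, 0 ≤ b i - a i ∧ b i - a i ≤ 1 := fun i => by simp only [ha, hb]; omega
  have key1 := fun i j => sq_add_sq_half ((p i : ℤ) - p j) ((q i : ℤ) - q j) (a i - a j) (b i - b j)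
    (by have := hab i; have := hab j; omega)
    (by have := hab1 i; have := hab1 j; rw [abs_le]; omega)
  have key2 := fun i => sq_add_sq_half (p i : ℤ) (q i : ℤ) (a i) (b i)
    (by have := hab i; omega) (by have := hab1 i; rw [abs_le]; omega)
  have hZ : ∑ i, ∑ j, (((p i : ℤ) - p j) ^ 2 + ((q i : ℤ) - q j) ^ 2) +
      ∑ i, ((p i : ℤ) ^ 2 + (q i : ℤ) ^ 2) ≤
      ∑ i, ∑ j, ((a i - a j) ^ 2 + (b i - b j) ^ 2) + ∑ i, (a i ^ 2 + b i ^ 2) := by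
    simp only [energy] at h
    have h' : (∑ i, ∑ j, (((p i : ℝ) - p j) ^ 2 + ((q i : ℝ) - q j) ^ 2) +
      ∑ i, ((p i : ℝ) ^ 2 + (q i : ℝ) ^ 2)) ≤
      ∑ i, ∑ j, (((a i : ℝ) - a j) ^ 2 + ((b i : ℝ) - b j) ^ 2) +
        ∑ i, ((a i : ℝ) ^ 2 + (b i : ℝ) ^ 2) := by
      simp only [Finset.sum_add_distrib, ha, hb, Int.cast_natCast]
      linarith
    exact_mod_cast h'
  have s1 : ∑ i, ∑ j, ((a i - a j) ^ 2 + (b i - b j) ^ 2) ≤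
      ∑ i, ∑ j, (((p i : ℤ) - p j) ^ 2 + ((q i : ℤ) - q j) ^ 2) :=
    Finset.sum_le_sum fun i _ => Finset.sum_le_sum fun j _ => (key1 i j).1
  have s2 : ∑ i, (a i ^ 2 + b i ^ 2) ≤ ∑ i, ((p i : ℤ) ^ 2 + (q i : ℤ) ^ 2) :=
    Finset.sum_le_sum fun i _ => (key2 i).1
  have t1 : ∑ i, ∑ j, ((a i - a j) ^ 2 + (b i - b j) ^ 2) =
      ∑ i, ∑ j, (((p i : ℤ) - p j) ^ 2 + ((q i : ℤ) - q j) ^ 2) := by linarith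
  have t2 : ∑ i, (a i ^ 2 + b i ^ 2) = ∑ i, ((p i : ℤ) ^ 2 + (q i : ℤ) ^ 2) := by linarith
  have d2 : ∀ i, |(p i : ℤ) - q i| ≤ 1 := fun i =>
    (key2 i).2 ((Finset.sum_eq_sum_iff_of_le fun i _ => (key2 i).1).1 t2 i (Finset.mem_univ i))
  have d1 : ∀ i j, |((p i : ℤ) - p j) - ((q i : ℤ) - q j)| ≤ 1 := fun i j =>
    (key1 i j).2 ((Finset.sum_eq_sum_iff_of_le fun j _ => (key1 i j).1).1
      ((Finset.sum_eq_sum_iff_of_le fun i _ => Finset.sum_le_sum fun j _ => (key1 i j).1).1 t1 i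
        (Finset.mem_univ i)) j (Finset.mem_univ j))
  -- If `p j = q j + 1` for one `j`, the bound `d1` excludes `p i < q i` for every other `i`.
  by_cases hle : ∀ i, p i ≤ q i
  · left
    intro i
    have := abs_le.1 (d2 i)
    have := hle i
    omega
  · right
    push Not at hle
    obtain ⟨j, hj⟩ := hle
    intro i
    have := abs_le.1 (d2 i)
    have := abs_le.1 (d1 i j)
    omega

end CubePoint

/-! ### The compatibility graph and its realization by convex heights. -/

namespace CubePoint

variable {n r : ℕ}

theorem Step.refl (p : CubePoint n r) : Step p p := fun _ => ⟨le_rfl, Nat.le_succ _⟩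

/-- Vertices of the polytope: the lattice points of `max x = r`, and the vectors `-e_i`. -/
abbrev Vertex (n r : ℕ) : Type := CubePoint n r ⊕ Fin n

/-- Compatibility of vertices. -/
def Compat : Vertex n r → Vertex n r → Prop
  | .inl p, .inl q => Step p q ∨ Step q p
  | .inl p, .inr i => p i = 0
  | .inr i, .inl p => p i = 0
  | .inr _, .inr _ => True

/-- The graph whose clique complex is the boundary complex of the polytope. -/
def vertexGraph (n r : ℕ) : SimpleGraph (Vertex n r) where
  Adj v w := v ≠ w ∧ Compat v w
  symm := ⟨by
    rintro (p | i) (q | j) ⟨h1, h2⟩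
    · exact ⟨h1.symm, Or.symm h2⟩
    · exact ⟨h1.symm, h2⟩
    · exact ⟨h1.symm, h2⟩
    · exact ⟨h1.symm, h2⟩⟩
  loopless := ⟨fun v h => h.1 rfl⟩

theorem isClique_iff (s : Finset (Vertex n r)) :
    (vertexGraph n r).IsClique (s : Set (Vertex n r)) ↔
      IsChainSet s.toLeft ∧ ∀ p ∈ s.toLeft, ∀ i ∈ s.toRight, p i = 0 := by
  constructor
  · intro h
    refine ⟨fun p hp q hq => ?_, fun p hp i hi => ?_⟩
    · by_cases hpq : p = q
      · subst hpq; exact Or.inl (Step.refl p)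
      · exact (h (Finset.mem_toLeft.1 hp) (Finset.mem_toLeft.1 hq) (by simpa using hpq)).2
    · exact (h (Finset.mem_toLeft.1 hp) (Finset.mem_toRight.1 hi) (by simp)).2
  · rintro ⟨h1, h2⟩ (p | i) hv (q | j) hw hvw
    · exact ⟨hvw, h1 p (Finset.mem_toLeft.2 hv) q (Finset.mem_toLeft.2 hw)⟩
    · exact ⟨hvw, h2 p (Finset.mem_toLeft.2 hv) j (Finset.mem_toRight.2 hw)⟩
    · exact ⟨hvw, h2 q (Finset.mem_toLeft.2 hw) i (Finset.mem_toRight.2 hv)⟩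
    · exact ⟨hvw, trivial⟩

/-- The value at a vertex of the linear functional with coefficients `a`. -/
def pairing (a : Fin n → ℝ) : Vertex n r → ℝ
  | .inl p => ∑ i, a i * p i
  | .inr i => -a i

/-- Lowering all nonzero entries of `x` by one removes the indicator of its support, worth at most
`C`, and lowers the bound `M` by one. -/
theorem sum_mul_le_of_level_sets {a : Fin n → ℝ} {c C : ℝ}
    (hS : ∀ S : Finset (Fin n), S.Nonempty → c * ∑ i ∈ S, a i ≤ C) (hC : 0 ≤ C) (M : ℕ) :
    ∀ x : Fin n → ℕ, (∀ i, x i ≤ M) → c * ∑ i, a i * x i ≤ M * C := by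
  induction M with
  | zero =>
    intro x hx
    have : ∀ i, x i = 0 := fun i => Nat.le_zero.1 (hx i)
    simp [this]
  | succ M ih =>
    intro x hx
    have h1 := ih (fun i => x i - 1) fun i => by have := hx i; omega
    have h2 : c * ∑ i ∈ Finset.univ.filter (fun i => x i ≠ 0), a i ≤ C := by
      rcases (Finset.univ.filter (fun i => x i ≠ 0)).eq_empty_or_nonempty with h | h
      · rw [h]; simpa using hC
      · exact hS _ h
    have h3 : ∑ i, a i * x i =
        ∑ i, a i * (x i - 1 : ℕ) + ∑ i ∈ Finset.univ.filter (fun i => x i ≠ 0), a i := by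
      rw [Finset.sum_filter, ← Finset.sum_add_distrib]
      refine Finset.sum_congr rfl fun i _ => ?_
      by_cases h : x i = 0
      · simp [h]
      · have : 1 ≤ x i := Nat.one_le_iff_ne_zero.2 h
        rw [if_pos h]
        push_cast [this]
        ring
    rw [h3, mul_add]
    push_cast
    linarith

theorem linear_apply_eq_sum (L : (Fin n → ℝ) →ₗ[ℝ] ℝ) (x : Fin n → ℝ) :
    L x = ∑ i, L (Pi.single i 1) * x i := by
  classical
  rw [LinearMap.pi_apply_eq_sum_univ L x]
  refine Finset.sum_congr rfl fun i _ => ?_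
  rw [smul_eq_mul, mul_comm]
  congr 2
  ext j
  simp [Pi.single_apply, eq_comm]

/-- The height function `K + energy`, with a large constant `R` at the vertices `-e_i`. -/
noncomputable def height (K R : ℝ) : Vertex n r → ℝ
  | .inl p => K + energy fun i => (p i : ℝ)
  | .inr _ => R

/-- The affine minorant of the energy on a cell becomes linear after its constant is absorbed into
the coordinate `m` where the cell has the value `r`. All other lattice points have `x_m ≤ r`, so for
`K ≥ C` the inequality survives. Lowering the coefficients at the chosen `-e_i` to `-R` then makes
these vertices tight too, without affecting the cell, whose points vanish there. -/
theorem exists_supporting_coeffs (hn : 0 < n) (hr : 0 < r) :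
    ∃ K₀ : ℝ, ∀ K, K₀ ≤ K → ∃ R₀ : ℝ, ∀ R, R₀ ≤ R → ∀ s : Finset (Vertex n r),
      (vertexGraph n r).IsClique (s : Set (Vertex n r)) →
      ∃ a : Fin n → ℝ, (∀ v : Vertex n r, pairing a v ≤ height K R v) ∧
        ∀ v ∈ s, pairing a v = height K R v := by
  classical
  have h0 : ∀ P : Finset (CubePoint n r), ∃ (C : ℝ) (L : (Fin n → ℝ) →ₗ[ℝ] ℝ) (m : Fin n),
      P.Nonempty → IsChainSet P →
      (∀ p : CubePoint n r, L (fun i => p i) ≤ energy (fun i => (p i : ℝ)) + C) ∧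
      (∀ p ∈ P, L (fun i => p i) = energy (fun i => (p i : ℝ)) + C) ∧ ∀ p ∈ P, p m = r := by
    intro P
    by_cases h : P.Nonempty ∧ IsChainSet P
    · obtain ⟨C, L, h1, h2⟩ := h.2.exists_affine_minorant h.1
      obtain ⟨m, hm⟩ := h.2.exists_common_max h.1
      exact ⟨C, L, m, fun _ _ => ⟨h1, h2, hm⟩⟩
    · exact ⟨0, 0, ⟨0, hn⟩, fun h1 h2 => absurd ⟨h1, h2⟩ h⟩
  choose C L m hCL using h0
  obtain ⟨K₁, hK₁⟩ := (Set.finite_range C).bddAbove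
  refine ⟨max K₁ 0, fun K hK => ?_⟩
  have hKC : ∀ P, C P ≤ K := fun P => (hK₁ ⟨P, rfl⟩).trans ((le_max_left _ _).trans hK)
  have hK0 : 0 ≤ K := (le_max_right _ _).trans hK
  set L' : Finset (CubePoint n r) → (Fin n → ℝ) →ₗ[ℝ] ℝ := fun P =>
    L P + ((K - C P) / r) • LinearMap.proj (R := ℝ) (φ := fun _ => ℝ) (m P) with hL'
  obtain ⟨R₁, hR₁⟩ := (Set.finite_range fun z : Finset (CubePoint n r) × Fin n =>
    -L' z.1 (Pi.single z.2 1)).bddAbove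
  refine ⟨max R₁ 0, fun R hR s hs => ?_⟩
  have hR0 : 0 ≤ R := (le_max_right _ _).trans hR
  have hRL : ∀ P i, -L' P (Pi.single i 1) ≤ R := fun P i =>
    (hR₁ ⟨(P, i), rfl⟩).trans ((le_max_left _ _).trans hR)
  obtain ⟨hchain, hzero⟩ := (isClique_iff s).1 hs
  -- it suffices to adjust a functional that works for the lattice points
  suffices h : ∃ a : Fin n → ℝ, (∀ i, -a i ≤ R) ∧
      (∀ p : CubePoint n r, ∑ i, a i * p i ≤ K + energy fun i => (p i : ℝ)) ∧
      ∀ p ∈ s.toLeft, ∑ i, a i * p i = K + energy fun i => (p i : ℝ) by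
    obtain ⟨a, ha1, ha2, ha3⟩ := h
    refine ⟨fun i => if i ∈ s.toRight then -R else a i, ?_, ?_⟩
    · rintro (p | i)
      · refine le_trans (Finset.sum_le_sum fun i _ => ?_) (ha2 p)
        refine mul_le_mul_of_nonneg_right ?_ (Nat.cast_nonneg _)
        dsimp only
        split_ifs
        · linarith [ha1 i]
        · exact le_rfl
      · change -(if i ∈ s.toRight then -R else a i) ≤ R
        split_ifs
        · simp
        · exact ha1 i
    · rintro (p | i) hv
      · rw [← Finset.mem_toLeft] at hv
        refine Eq.trans (Finset.sum_congr rfl fun i _ => ?_) (ha3 p hv)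
        dsimp only
        split_ifs with hi
        · rw [hzero p hv i hi]; simp
        · rfl
      · change -(if i ∈ s.toRight then -R else a i) = R
        rw [if_pos (Finset.mem_toRight.2 hv)]
        simp
  rcases s.toLeft.eq_empty_or_nonempty with he | hne
  · refine ⟨0, fun _ => by simpa using hR0, fun p => ?_, by simp [he]⟩
    have := energy_nonneg fun i => (p i : ℝ)
    simp only [Pi.zero_apply, zero_mul, Finset.sum_const_zero]
    linarith
  obtain ⟨h1, h2, h3⟩ := hCL s.toLeft hne hchain
  have hr' : (0 : ℝ) < r := by exact_mod_cast hr
  refine ⟨fun i => L' s.toLeft (Pi.single i 1), hRL _, fun p => ?_, fun p hp => ?_⟩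
  · rw [← linear_apply_eq_sum (L' s.toLeft) fun i => (p i : ℝ)]
    have hp := h1 p
    have : (K - C s.toLeft) / r * p (m s.toLeft) ≤ K - C s.toLeft := by
      rw [div_mul_eq_mul_div, div_le_iff₀ hr']
      exact mul_le_mul_of_nonneg_left (by exact_mod_cast p.le _) (by linarith [hKC s.toLeft])
    simp only [hL', LinearMap.add_apply, LinearMap.smul_apply, LinearMap.proj_apply, smul_eq_mul]
    linarith
  · rw [← linear_apply_eq_sum (L' s.toLeft) fun i => (p i : ℝ)]
    have := h2 p hp
    simp only [hL', LinearMap.add_apply, LinearMap.smul_apply, LinearMap.proj_apply, smul_eq_mul,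
      h3 p hp, this]
    field_simp
    ring

/-- A functional below the heights is at most `M * (K + B) / r` on vectors with entries in `[0, M]`.
Two tight points without a common coordinate `r` have a sum with entries at most `2 * r - 1` and
value at least `2 * K`, too much for large `K`; with a common one, the rounded midpoints are lattice
points of the complex and discrete convexity applies. If `-e_i` is tight and `p i > 0`, setting `p
i` to zero gains at least `R`, also too much. -/
theorem compat_of_tight {K R B : ℝ} (hr : 0 < r) (hB : 0 ≤ B)
    (hBE : ∀ p : CubePoint n r, energy (fun i => (p i : ℝ)) ≤ B)
    (hK : (2 * r - 1) * B < K) (hK0 : 0 ≤ K) (hR : K + B < R) {a : Fin n → ℝ}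
    (ha : ∀ v : Vertex n r, pairing a v ≤ height K R v) {v w : Vertex n r}
    (hv : pairing a v = height K R v) (hw : pairing a w = height K R w) : Compat v w := by
  classical
  have hr' : (0 : ℝ) < r := by exact_mod_cast hr
  have hlevel : ∀ S : Finset (Fin n), S.Nonempty → (r : ℝ) * ∑ i ∈ S, a i ≤ K + B := by
    rintro S ⟨j, hj⟩
    have h1 := ha (.inl (mk' (fun i => if i ∈ S then r else 0) (fun i => by split_ifs <;> simp)
      ⟨j, if_pos hj⟩))
    have h2 := hBE (mk' (fun i => if i ∈ S then r else 0) (fun i => by split_ifs <;> simp)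
      ⟨j, if_pos hj⟩)
    change ∑ i, a i * ((if i ∈ S then r else 0 : ℕ) : ℝ) ≤ K + _ at h1
    have h3 : ∑ i, a i * ((if i ∈ S then r else 0 : ℕ) : ℝ) = (r : ℝ) * ∑ i ∈ S, a i := by
      rw [Finset.mul_sum, ← Finset.sum_subset (Finset.subset_univ S)]
      · refine Finset.sum_congr rfl fun i hi => ?_
        rw [if_pos hi, mul_comm]
      · intro i _ hi
        simp [hi]
    linarith
  have hbound := sum_mul_le_of_level_sets hlevel (by linarith)
  have hzero : ∀ (p : CubePoint n r) (i : Fin n), pairing a (.inl p : Vertex n r) =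
      height K R (.inl p : Vertex n r) →
      pairing a (.inr i : Vertex n r) = height K R (.inr i : Vertex n r) → p i = 0 := by
    intro p i hp hi
    by_contra hpi
    have h1 := hbound r (Function.update p i 0) fun j => by
      by_cases hj : j = i
      · subst hj; simp
      · rw [Function.update_of_ne hj]; exact p.le j
    have h2 : ∑ j, a j * p j = ∑ j, a j * (Function.update p i 0 j : ℕ) + a i * p i := by
      rw [← Finset.add_sum_erase _ _ (Finset.mem_univ i),
        ← Finset.add_sum_erase _ (fun j => a j * (Function.update p i 0 j : ℕ)) (Finset.mem_univ i)]
      rw [Finset.sum_congr rfl (g := fun j => a j * (Function.update p i 0 j : ℕ))]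
      · simp [add_comm]
      · intro j hj
        rw [Function.update_of_ne (Finset.ne_of_mem_erase hj)]
    change ∑ j, a j * p j = K + energy _ at hp
    change -a i = R at hi
    have h3 := energy_nonneg fun i => (p i : ℝ)
    have h4 : (1 : ℝ) ≤ p i := by exact_mod_cast Nat.one_le_iff_ne_zero.2 hpi
    have h5 : ∑ j, a j * (Function.update p i 0 j : ℕ) ≤ K + B := le_of_mul_le_mul_left h1 hr'
    have h6 : a i = -R := by linarith
    rw [h6] at h2
    nlinarith
  rcases v with p | i <;> rcases w with q | j
  · change ∑ i, a i * p i = K + energy _ at hv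
    change ∑ i, a i * q i = K + energy _ at hw
    have hsum : ∑ i, a i * ((p i + q i : ℕ) : ℝ) = ∑ i, a i * p i + ∑ i, a i * q i := by
      rw [← Finset.sum_add_distrib]
      exact Finset.sum_congr rfl fun i _ => by push_cast; ring
    by_cases hcommon : ∃ i, p i = r ∧ q i = r
    · obtain ⟨m, hpm, hqm⟩ := hcommon
      apply step_of_energy_le
      have h1 := ha (.inl (mk' (fun i => (p i + q i) / 2)
        (fun i => by have := p.le i; have := q.le i; omega) ⟨m, by omega⟩))
      have h2 := ha (.inl (mk' (fun i => (p i + q i + 1) / 2)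
        (fun i => by have := p.le i; have := q.le i; omega) ⟨m, by omega⟩))
      change ∑ i, a i * (((p i + q i) / 2 : ℕ) : ℝ) ≤
        K + energy (fun i => (((p i + q i) / 2 : ℕ) : ℝ)) at h1
      change ∑ i, a i * (((p i + q i + 1) / 2 : ℕ) : ℝ) ≤
        K + energy (fun i => (((p i + q i + 1) / 2 : ℕ) : ℝ)) at h2
      have h3 : ∑ i, a i * (((p i + q i) / 2 : ℕ) : ℝ) +
          ∑ i, a i * (((p i + q i + 1) / 2 : ℕ) : ℝ) = ∑ i, a i * ((p i + q i : ℕ) : ℝ) := by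
        rw [← Finset.sum_add_distrib]
        refine Finset.sum_congr rfl fun i _ => ?_
        rw [← mul_add, ← Nat.cast_add]
        congr 2
        omega
      linarith
    · exfalso
      have h1 := hbound (2 * r - 1) (fun i => p i + q i) fun i => by
        have := p.le i
        have := q.le i
        by_contra hlt
        exact hcommon ⟨i, by omega, by omega⟩
      rw [hsum, hv, hw, Nat.cast_sub (by omega)] at h1
      push_cast at h1
      have h2 := energy_nonneg fun i => (p i : ℝ)
      have h3 := energy_nonneg fun i => (q i : ℝ)
      have h4 : (r : ℝ) * (2 * K) ≤ (2 * r - 1) * (K + B) := le_trans (by nlinarith) h1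
      nlinarith
  · exact hzero p j hv hw
  · exact hzero q i hw hv
  · trivial

/-- The position vector of a vertex. -/
noncomputable def position : Vertex n r → EuclideanSpace ℝ (Fin n)
  | .inl p => WithLp.toLp 2 fun i => (p i : ℝ)
  | .inr i => -EuclideanSpace.single i 1

/-- The linear functional with prescribed coefficients. -/
noncomputable def functional (a : Fin n → ℝ) : EuclideanSpace ℝ (Fin n) →ₗ[ℝ] ℝ :=
  ∑ i, a i • ((EuclideanSpace.proj i : EuclideanSpace ℝ (Fin n) →L[ℝ] ℝ) :
    EuclideanSpace ℝ (Fin n) →ₗ[ℝ] ℝ)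

theorem functional_apply (a : Fin n → ℝ) (x : EuclideanSpace ℝ (Fin n)) :
    functional a x = ∑ i, a i * x i := by
  simp [functional]

theorem functional_position (a : Fin n → ℝ) (v : Vertex n r) :
    functional a (position v) = pairing a v := by
  rw [functional_apply]
  rcases v with p | i
  · rfl
  · simp [position, pairing]

theorem eq_functional (l : EuclideanSpace ℝ (Fin n) →ₗ[ℝ] ℝ) :
    l = functional fun i => l (EuclideanSpace.single i 1) := by
  apply (EuclideanSpace.basisFun (Fin n) ℝ).toBasis.ext
  intro i
  rw [functional_apply]
  simp

theorem exists_heights (hn : 0 < n) (hr : 0 < r) :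
    ∃ φ : Vertex n r → ℝ, (∀ v, 0 < φ v) ∧
      (∀ s : Finset (Vertex n r), (vertexGraph n r).IsClique (s : Set (Vertex n r)) →
        ∃ a : Fin n → ℝ, (∀ v, pairing a v ≤ φ v) ∧ ∀ v ∈ s, pairing a v = φ v) ∧
      ∀ a : Fin n → ℝ, (∀ v, pairing a v ≤ φ v) → ∀ v w, pairing a v = φ v →
        pairing a w = φ w → Compat v w := by
  obtain ⟨B₀, hB₀⟩ := (Set.finite_range fun p : CubePoint n r =>
    energy fun i => (p i : ℝ)).bddAbove
  set B := max B₀ 0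
  have hB : 0 ≤ B := le_max_right _ _
  have hBE : ∀ p : CubePoint n r, energy (fun i => (p i : ℝ)) ≤ B := fun p =>
    (hB₀ ⟨p, rfl⟩).trans (le_max_left _ _)
  obtain ⟨K₀, hK₀⟩ := exists_supporting_coeffs hn hr
  have h1r : (1 : ℝ) ≤ r := by exact_mod_cast hr
  -- The constant `K` has to beat the minorants and `(2 * r - 1) * B`; only afterwards can `R` be
  -- chosen, since its bound depends on `K`.
  set K := max K₀ ((2 * r - 1) * B + 1)
  have hK1 : (2 * r - 1) * B + 1 ≤ K := le_max_right _ _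
  have hKpos : 0 < K := by nlinarith
  obtain ⟨R₀, hR₀⟩ := hK₀ K (le_max_left _ _)
  set R := max R₀ (K + B + 1)
  have hR1 : K + B + 1 ≤ R := le_max_right _ _
  refine ⟨height K R, ?_, hR₀ R (le_max_left _ _), fun a ha v w hv hw =>
    compat_of_tight hr hB hBE (by linarith) hKpos.le (by linarith) ha hv hw⟩
  rintro (p | i)
  · have := energy_nonneg fun i => (p i : ℝ)
    change 0 < K + energy _
    linarith
  · change 0 < R
    linarith

/-- The vertices, suitably rescaled, realize the clique complex of `vertexGraph` as the boundary
complex of a convex polytope. -/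
theorem exists_isCliqueRealization (hn : 0 < n) (hr : 0 < r) :
    ∃ φ : Vertex n r → ℝ, (∀ v, 0 < φ v) ∧
      IsCliqueRealization (vertexGraph n r) fun v => (φ v)⁻¹ • position v := by
  classical
  obtain ⟨φ, hφ, hsupp, hcompat⟩ := exists_heights (n := n) (r := r) hn hr
  have hle : ∀ (a : Fin n → ℝ) v, functional a ((φ v)⁻¹ • position v) ≤ 1 ↔
      pairing a v ≤ φ v := fun a v => by
    rw [map_smul, functional_position, smul_eq_mul, inv_mul_le_iff₀ (hφ v), mul_one]
  have heq : ∀ (a : Fin n → ℝ) v, functional a ((φ v)⁻¹ • position v) = 1 ↔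
      pairing a v = φ v := fun a v => by
    rw [map_smul, functional_position, smul_eq_mul, inv_mul_eq_iff_eq_mul₀ (hφ v).ne', mul_one]
  refine ⟨φ, hφ, ?_, ?_, ?_, ?_⟩
  · intro s hs hne
    obtain ⟨hchain, hzero⟩ := (isClique_iff s).1 hs
    suffices h : ∃ v ∈ s, ∃ a : Fin n → ℝ, pairing a v ≠ 0 ∧
        ∀ w ∈ s, w ≠ v → pairing a w = 0 by
      obtain ⟨v, hv, a, ha1, ha2⟩ := h
      refine ⟨v, hv, functional a, ?_, fun w hw hwv => ?_⟩
      · rw [map_smul, functional_position]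
        exact smul_ne_zero (inv_ne_zero (hφ v).ne') ha1
      · rw [map_smul, functional_position, ha2 w hw hwv, smul_zero]
    -- Coordinate `i` separates a vertex `-e_i` from the rest of its clique; without such a vertex,
    -- the top lattice point is peeled off.
    by_cases hright : s.toRight.Nonempty
    · obtain ⟨i, hi⟩ := hright
      refine ⟨.inr i, Finset.mem_toRight.1 hi, Pi.single i 1, by simp [pairing], ?_⟩
      rintro (p | j) hw hwv
      · simp [pairing, Pi.single_apply, hzero p (Finset.mem_toLeft.2 hw) i hi]
      · have : j ≠ i := fun h => hwv (by rw [h])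
        simp [pairing, this]
    · rw [Finset.not_nonempty_iff_eq_empty] at hright
      have hl : s.toLeft.Nonempty := by
        obtain ⟨v, hv⟩ := hne
        rcases v with p | i
        · exact ⟨p, Finset.mem_toLeft.2 hv⟩
        · have := Finset.mem_toRight.2 hv
          simp [hright] at this
      obtain ⟨p, hp, a, ha1, ha2⟩ := hchain.exists_dual hr hl
      refine ⟨.inl p, Finset.mem_toLeft.1 hp, a, ha1, ?_⟩
      rintro (q | j) hw hwv
      · exact ha2 q (Finset.mem_toLeft.2 hw) fun h => hwv (by rw [h])
      · have := Finset.mem_toRight.2 hw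
        simp [hright] at this
  · intro s hs
    obtain ⟨a, ha1, ha2⟩ := hsupp s hs
    exact ⟨functional a, fun v => (hle a v).2 (ha1 v), fun v hv => (heq a v).2 (ha2 v hv)⟩
  · intro l hl v w hv hw hvw
    rw [eq_functional l] at hl hv hw
    exact ⟨hvw, hcompat _ (fun v => (hle _ v).1 (hl v)) v w ((heq _ v).1 hv) ((heq _ w).1 hw)⟩
  · intro l hl
    rw [eq_functional l] at hl ⊢
    set a : Fin n → ℝ := fun i => l (EuclideanSpace.single i 1)
    have hl' : ∀ v : Vertex n r, pairing a v ≤ 0 := fun v => by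
      have := hl v
      rw [map_smul, functional_position, smul_eq_mul] at this
      by_contra h
      push Not at h
      exact absurd this (not_le.2 (mul_pos (inv_pos.2 (hφ v)) h))
    -- The vertices `-e_i` and `r e_i` bound the coefficient `a i` from both sides.
    have ha : a = 0 := by
      ext i
      have h1 := hl' (.inr i)
      have h2 := hl' (.inl (mk' (Pi.single i r)
        (fun j => by by_cases h : j = i
                     · subst h; simp
                     · simp [h]) ⟨i, by simp⟩))
      change -a i ≤ 0 at h1
      change ∑ j, a j * ((Pi.single i r : Fin n → ℕ) j : ℝ) ≤ 0 at h2
      have h3 : ∑ j, a j * ((Pi.single i r : Fin n → ℕ) j : ℝ) = a i * r := by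
        rw [Finset.sum_eq_single i]
        · simp
        · intro j _ hj; simp [hj]
        · simp
      rw [h3] at h2
      have hr' : (0 : ℝ) < r := by exact_mod_cast hr
      have : a i ≤ 0 := by
        by_contra h
        push Not at h
        exact absurd h2 (not_le.2 (mul_pos h hr'))
      simp only [Pi.zero_apply]
      linarith
    rw [ha]
    ext i
    simp [functional]

end CubePoint

/-! ### Formal sums of power series weighted by powers of the variable. -/

namespace PowerSeries

variable {R : Type*} [CommRing R]

/-- The formal sum `∑ j, X ^ j * g j`. -/
noncomputable def shiftSum (g : ℕ → PowerSeries R) : PowerSeries R :=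
  mk fun d => ∑ j ∈ Finset.range (d + 1), coeff (d - j) (g j)

theorem shiftSum_eq (g : ℕ → PowerSeries R) :
    shiftSum g = g 0 + X * shiftSum fun j => g (j + 1) := by
  ext d
  rcases d with _ | d
  · simp [shiftSum]
  · rw [map_add, coeff_succ_X_mul]
    simp only [shiftSum, coeff_mk]
    rw [Finset.sum_range_succ', add_comm]
    simp

theorem shiftSum_sub (g h : ℕ → PowerSeries R) :
    shiftSum (fun j => g j - h j) = shiftSum g - shiftSum h := by
  ext d
  simp [shiftSum, Finset.sum_sub_distrib]

theorem shiftSum_sum {ι : Type*} (s : Finset ι) (g : ι → ℕ → PowerSeries R) :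
    shiftSum (fun j => ∑ i ∈ s, g i j) = ∑ i ∈ s, shiftSum (g i) := by
  ext d
  simp only [shiftSum, map_sum, coeff_mk]
  exact Finset.sum_comm

theorem shiftSum_mul_left (a : PowerSeries R) (g : ℕ → PowerSeries R) :
    shiftSum (fun j => a * g j) = a * shiftSum g := by
  ext d
  induction d generalizing g with
  | zero =>
    rw [shiftSum_eq, shiftSum_eq g]
    simp
  | succ d ih =>
    rw [shiftSum_eq, shiftSum_eq g, mul_add, mul_left_comm, map_add, map_add, coeff_succ_X_mul,
      coeff_succ_X_mul, ih]

theorem shiftSum_natCast (N : ℕ → ℕ) :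
    shiftSum (fun j => (N j : PowerSeries R)) = mk fun j => (N j : R) := by
  ext d
  simp only [shiftSum, coeff_mk]
  rw [Finset.sum_eq_single d]
  · simp
  · intro j hj hjd
    have : d - j ≠ 0 := by have := Finset.mem_range.1 hj; omega
    rw [← map_natCast (C (R := R)), coeff_C, if_neg this]
  · simp

end PowerSeries

/-- Integer polynomials as power series with rational coefficients. -/
noncomputable def toSeries : ℤ[X] →+* PowerSeries ℚ :=
  (coeToPowerSeries.ringHom (R := ℚ)).comp (mapRingHom (Int.castRingHom ℚ))

theorem toSeries_injective : Function.Injective toSeries := by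
  intro p q h
  have h1 : p.map (Int.castRingHom ℚ) = q.map (Int.castRingHom ℚ) := by
    apply Polynomial.coe_injective ℚ
    simpa [toSeries] using h
  exact Polynomial.map_injective _ Int.cast_injective h1

@[simp]
theorem toSeries_X : toSeries X = PowerSeries.X := by simp [toSeries]

/-! ### Unique decomposition of lattice vectors along Kuhn cells. -/

namespace CubePoint

variable {n r : ℕ}

theorem IsChainSet.eq_zero_of_sum_eq_zero (hr : 0 < r) {P : Finset (CubePoint n r)}
    (hP : IsChainSet P) (c : CubePoint n r → ℝ) (hc : ∀ i, ∑ p ∈ P, c p * p i = 0) :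
    ∀ p ∈ P, c p = 0 := by
  classical
  induction P using Finset.strongInduction with
  | H P ih =>
    rcases P.eq_empty_or_nonempty with rfl | hne
    · simp
    obtain ⟨p, hp, a, hap, ha⟩ := hP.exists_dual hr hne
    have h1 : ∑ q ∈ P, c q * ∑ i, a i * q i = 0 := by
      simp only [Finset.mul_sum]
      rw [Finset.sum_comm]
      refine Finset.sum_eq_zero fun i _ => ?_
      rw [Finset.sum_congr rfl (g := fun q => a i * (c q * q i)) fun q _ => by ring,
        ← Finset.mul_sum, hc i, mul_zero]
    rw [Finset.sum_eq_single_of_mem p hp fun q hq hqp => by rw [ha q hq hqp, mul_zero]] at h1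
    have hcp : c p = 0 := (mul_eq_zero.1 h1).resolve_right hap
    intro q hq
    by_cases hqp : q = p
    · rw [hqp, hcp]
    · refine ih (P.erase p) (Finset.erase_ssubset hp) (hP.subset (Finset.erase_subset p P))
        (fun i => ?_) q (Finset.mem_erase.2 ⟨hqp, hq⟩)
      have := hc i
      rw [← Finset.add_sum_erase _ _ hp, hcp, zero_mul, zero_add] at this
      exact this

/-- The lattice point represented by a nonnegative combination of vertices. -/
def combination (l : CubePoint n r →₀ ℕ) (i : Fin n) : ℕ := ∑ p, l p * p i

/-- A functional tight on the support of `l` shows that the total height of `l` is at most that of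
`l'`. By symmetry the totals agree, so the same functional is tight on both supports. Their union is
a chain set, hence linearly independent, and the coefficients coincide. -/
theorem combination_injOn (hn : 0 < n) (hr : 0 < r) {l l' : CubePoint n r →₀ ℕ}
    (hl : IsChainSet l.support) (hl' : IsChainSet l'.support)
    (h : combination l = combination l') : l = l' := by
  classical
  obtain ⟨φ, hφ, hsupp, hcompat⟩ := exists_heights (n := n) (r := r) hn hr
  have hsum : ∀ (m : CubePoint n r →₀ ℕ) (a : Fin n → ℝ),
      ∑ i, a i * combination m i = ∑ p, (m p : ℝ) * pairing a (.inl p : Vertex n r) := by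
    intro m a
    simp only [combination, pairing, Nat.cast_sum, Nat.cast_mul, Finset.mul_sum]
    rw [Finset.sum_comm]
    exact Finset.sum_congr rfl fun p _ => Finset.sum_congr rfl fun i _ => by ring
  have hle : ∀ m m' : CubePoint n r →₀ ℕ, IsChainSet m.support → combination m = combination m' →
      ∃ a : Fin n → ℝ, (∀ v, pairing a v ≤ φ v) ∧
        (∀ p ∈ m.support, pairing a (.inl p : Vertex n r) = φ (.inl p)) ∧
        ∑ p, (m p : ℝ) * φ (.inl p) = ∑ p, (m' p : ℝ) * pairing a (.inl p : Vertex n r) := by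
    intro m m' hm hmm
    obtain ⟨a, ha1, ha2⟩ := hsupp (m.support.disjSum ∅)
      ((isClique_iff _).2 ⟨by rwa [Finset.toLeft_disjSum], by simp⟩)
    have ha3 : ∀ p ∈ m.support, pairing a (.inl p : Vertex n r) = φ (.inl p) := fun p hp =>
      ha2 _ (Finset.inl_mem_disjSum.2 hp)
    refine ⟨a, ha1, ha3, ?_⟩
    rw [← hsum, ← hmm, hsum]
    refine Finset.sum_congr rfl fun p _ => ?_
    by_cases hp : p ∈ m.support
    · rw [ha3 p hp]
    · rw [Finsupp.notMem_support_iff.1 hp]; simp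
  obtain ⟨a, ha1, ha2, ha3⟩ := hle l l' hl h
  obtain ⟨b, hb1, -, hb3⟩ := hle l' l hl' h.symm
  have key : ∀ p, (l' p : ℝ) * pairing a (.inl p : Vertex n r) ≤ (l' p : ℝ) * φ (.inl p) :=
    fun p => mul_le_mul_of_nonneg_left (ha1 _) (Nat.cast_nonneg _)
  have key' : ∑ p, (l p : ℝ) * pairing b (.inl p : Vertex n r) ≤ ∑ p, (l p : ℝ) * φ (.inl p) :=
    Finset.sum_le_sum fun p _ => mul_le_mul_of_nonneg_left (hb1 _) (Nat.cast_nonneg _)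
  have heq : ∑ p, (l' p : ℝ) * pairing a (.inl p : Vertex n r) = ∑ p, (l' p : ℝ) * φ (.inl p) :=
    le_antisymm (Finset.sum_le_sum fun p _ => key p) (by linarith)
  have htight : ∀ p ∈ l'.support, pairing a (.inl p : Vertex n r) = φ (.inl p) := fun p hp =>
    mul_left_cancel₀ (Nat.cast_ne_zero.2 (Finsupp.mem_support_iff.1 hp))
      ((Finset.sum_eq_sum_iff_of_le fun p _ => key p).1 heq p (Finset.mem_univ p))
  have hU : IsChainSet (l.support ∪ l'.support) := by
    have : ∀ p ∈ l.support ∪ l'.support, pairing a (.inl p : Vertex n r) = φ (.inl p) := by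
      intro p hp
      rcases Finset.mem_union.1 hp with hp | hp
      · exact ha2 p hp
      · exact htight p hp
    intro p hp q hq
    exact hcompat a ha1 _ _ (this p hp) (this q hq)
  have hzero := hU.eq_zero_of_sum_eq_zero hr (fun p => (l p : ℝ) - l' p) fun i => by
    have h1 : (combination l i : ℝ) = combination l' i := by rw [h]
    simp only [combination, Nat.cast_sum, Nat.cast_mul] at h1
    rw [Finset.sum_subset (Finset.subset_univ _)]
    · simp only [sub_mul, Finset.sum_sub_distrib]
      rw [h1, sub_self]
    · intro p _ hp
      simp only [Finset.mem_union, Finsupp.mem_support_iff, not_or, not_not] at hp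
      simp [hp.1, hp.2]
  ext p
  by_cases hp : p ∈ l.support ∪ l'.support
  · have := hzero p hp
    rw [sub_eq_zero] at this
    exact_mod_cast this
  · simp only [Finset.mem_union, Finsupp.mem_support_iff, not_or, not_not] at hp
    rw [hp.1, hp.2]

/-- Hermite's identity: passing from `a` to `a + 1` shifts the window of summands and trades `a / j`
for `(a + j) / j = a / j + 1`. -/
theorem sum_range_add_div (j : ℕ) (hj : 0 < j) (a : ℕ) :
    ∑ k ∈ Finset.range j, (a + k) / j = a := by
  induction a with
  | zero =>
    refine Finset.sum_eq_zero fun k hk => ?_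
    rw [zero_add, Nat.div_eq_of_lt (Finset.mem_range.1 hk)]
  | succ a ih =>
    obtain ⟨j, rfl⟩ : ∃ i, j = i + 1 := ⟨j - 1, by omega⟩
    have h1 : ∑ k ∈ Finset.range (j + 1), (a + 1 + k) / (j + 1) =
        ∑ k ∈ Finset.range j, (a + (k + 1)) / (j + 1) + (a / (j + 1) + 1) := by
      rw [Finset.sum_range_succ]
      congr 1
      · exact Finset.sum_congr rfl fun k _ => by congr 1; omega
      · rw [add_assoc, add_comm 1 j, Nat.add_div_right _ (Nat.succ_pos j)]
    rw [h1, ← add_assoc, ← add_left_inj 0]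
    have h2 := Finset.sum_range_succ' (fun k => (a + k) / (j + 1)) j
    rw [ih] at h2
    simp only [add_zero] at h2 ⊢
    omega

/-- Every vector with maximal coordinate `j * r` is the sum of a multiset of `j` lattice points
of a cell of the Kuhn triangulation. -/
theorem exists_combination_eq {j : ℕ} (hj : 0 < j) (x : Fin n → ℕ) (hx : ∀ i, x i ≤ j * r)
    (hmax : ∃ i, x i = j * r) :
    ∃ l : CubePoint n r →₀ ℕ, ∑ p, l p = j ∧ IsChainSet l.support ∧ combination l = x := by
  classical
  obtain ⟨m, hm⟩ := hmax
  have hdiv : ∀ a k, a ≤ j * r → k < j → (a + k) / j ≤ r := fun a k ha hk => by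
    rw [← Nat.lt_succ_iff, Nat.div_lt_iff_lt_mul hj, Nat.succ_mul, mul_comm r j]
    omega
  have hdivm : ∀ k, k < j → (x m + k) / j = r := fun k hk => by
    rw [hm, add_comm, Nat.add_mul_div_left _ _ hj, Nat.div_eq_of_lt hk, zero_add]
  -- The summands are the roundings `⌊(x + k) / j⌋` for `k < j`. They increase with `k` by at most
  -- one per coordinate, and all equal `r` at the maximum of `x`.
  let f : Fin j → CubePoint n r := fun k => mk' (fun i => (x i + k) / j)
    (fun i => hdiv _ _ (hx i) k.2) ⟨m, hdivm k k.2⟩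
  have hstep : ∀ k k' : Fin j, k ≤ k' → Step (f k) (f k') := by
    intro k k' hkk i
    refine ⟨Nat.div_le_div_right (by simpa using hkk), ?_⟩
    change (x i + k') / j ≤ (x i + k) / j + 1
    rw [← Nat.add_div_right _ hj]
    exact Nat.div_le_div_right (by have := k'.2; omega)
  refine ⟨∑ k, Finsupp.single (f k) 1, ?_, ?_, ?_⟩
  · simp only [Finsupp.coe_finsetSum, Finset.sum_apply]
    rw [Finset.sum_comm]
    simp [Finsupp.single_apply]
  · have hmem : ∀ p ∈ (∑ k, Finsupp.single (f k) 1).support, ∃ k, f k = p := by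
      intro p hp
      obtain ⟨k, -, hk⟩ := Finset.mem_biUnion.1 (Finsupp.support_finsetSum hp)
      exact ⟨k, (Finset.mem_singleton.1 (Finsupp.support_single_subset hk)).symm⟩
    intro p hp q hq
    obtain ⟨k, rfl⟩ := hmem p hp
    obtain ⟨k', rfl⟩ := hmem q hq
    rcases le_total k k' with h | h
    · exact Or.inl (hstep k k' h)
    · exact Or.inr (hstep k' k h)
  · ext i
    simp only [combination, Finsupp.coe_finsetSum, Finset.sum_apply, Finset.sum_mul]
    rw [Finset.sum_comm]
    have h1 : ∀ k : Fin j, ∑ p, (Finsupp.single (f k) 1 : CubePoint n r →₀ ℕ) p * p i =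
        (x i + k) / j := by
      intro k
      rw [Finset.sum_eq_single (f k)]
      · simp [f]
      · intro p _ hp
        simp [hp.symm]
      · simp
    simp only [h1]
    rw [Fin.sum_univ_eq_sum_range (fun k => (x i + k) / j) j]
    exact sum_range_add_div j hj (x i)

end CubePoint

/-! ### The `h`-polynomial by counting lattice vectors. -/

namespace CubePoint

variable {n r : ℕ}

/-- The coordinates vanishing on a set of lattice points. -/
def zeroCoords (P : Finset (CubePoint n r)) : Finset (Fin n) :=
  Finset.univ.filter fun i => ∀ p ∈ P, p i = 0

theorem mem_zeroCoords {P : Finset (CubePoint n r)} {i : Fin n} :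
    i ∈ zeroCoords P ↔ ∀ p ∈ P, p i = 0 := by simp [zeroCoords]

theorem isClique_disjSum_iff (P : Finset (CubePoint n r)) (I : Finset (Fin n)) :
    (vertexGraph n r).IsClique (P.disjSum I : Set (Vertex n r)) ↔
      IsChainSet P ∧ I ⊆ zeroCoords P := by
  rw [isClique_iff, Finset.toLeft_disjSum, Finset.toRight_disjSum]
  refine and_congr_right fun _ => ⟨fun h i hi => mem_zeroCoords.2 fun p hp => h p hp i hi,
    fun h p hp i hi => mem_zeroCoords.1 (h hi) p hp⟩

/-- A chain set and all `-e_i` along its zero coordinates form one clique, hence independent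
vectors. This keeps the subtractions in the exponents from truncating. -/
theorem card_add_card_zeroCoords_le (hn : 0 < n) (hr : 0 < r) {P : Finset (CubePoint n r)}
    (hP : IsChainSet P) : P.card + (zeroCoords P).card ≤ n := by
  obtain ⟨φ, -, h⟩ := exists_isCliqueRealization hn hr
  have := h.card_le_finrank (P.disjSum (zeroCoords P))
    ((isClique_disjSum_iff P _).2 ⟨hP, subset_rfl⟩)
  simpa using this

open Classical in
-- For a fixed set of lattice points, the compatible `-e_i` range over all subsets of the zero
-- coordinates, and their weights add up to a power of `X + (1 - X) = 1`.
theorem sum_cliques_eq (hn : 0 < n) (hr : 0 < r) :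
    ∑ s ∈ (Finset.univ : Finset (Finset (Vertex n r))).filter
        (fun s : Finset (Vertex n r) => (vertexGraph n r).IsClique (s : Set (Vertex n r))),
      (X : ℤ[X]) ^ s.card * (1 - X) ^ (n - s.card) =
    ∑ P ∈ (Finset.univ : Finset (Finset (CubePoint n r))).filter IsChainSet,
      X ^ P.card * (1 - X) ^ (n - P.card - (zeroCoords P).card) := by
  have h1 : ∀ P ∈ (Finset.univ : Finset (Finset (CubePoint n r))).filter IsChainSet,
      (X : ℤ[X]) ^ P.card * (1 - X) ^ (n - P.card - (zeroCoords P).card) =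
      ∑ I ∈ (zeroCoords P).powerset,
        X ^ (P.disjSum I).card * (1 - X) ^ (n - (P.disjSum I).card) := by
    intro P hP
    have hcard := card_add_card_zeroCoords_le hn hr (Finset.mem_filter.1 hP).2
    have h2 := Finset.sum_pow_mul_eq_add_pow (X : ℤ[X]) (1 - X) (zeroCoords P)
    rw [add_sub_cancel, one_pow] at h2
    have h3 : (X : ℤ[X]) ^ P.card * (1 - X) ^ (n - P.card - (zeroCoords P).card) =
        X ^ P.card * (1 - X) ^ (n - P.card - (zeroCoords P).card) *
          ∑ I ∈ (zeroCoords P).powerset, X ^ I.card * (1 - X) ^ ((zeroCoords P).card - I.card) := by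
      rw [h2, mul_one]
    rw [h3, Finset.mul_sum]
    refine Finset.sum_congr rfl fun I hI => ?_
    have hI' := Finset.card_le_card (Finset.mem_powerset.1 hI)
    rw [Finset.card_disjSum, pow_add]
    have : n - (P.card + I.card) =
        (n - P.card - (zeroCoords P).card) + ((zeroCoords P).card - I.card) := by omega
    rw [this, pow_add]
    ring
  rw [Finset.sum_congr rfl h1, Finset.sum_sigma']
  refine Finset.sum_bij' (fun s _ => ⟨s.toLeft, s.toRight⟩) (fun z _ => z.1.disjSum z.2)
    ?_ ?_ ?_ ?_ ?_
  · intro s hs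
    have hs' := (Finset.mem_filter.1 hs).2
    rw [← Finset.toLeft_disjSum_toRight (u := s), isClique_disjSum_iff] at hs'
    simpa using hs'
  · rintro ⟨P, I⟩ h
    simp only [Finset.mem_sigma, Finset.mem_filter, Finset.mem_univ, true_and,
      Finset.mem_powerset] at h ⊢
    exact (isClique_disjSum_iff P I).2 h
  · intro s _
    exact Finset.toLeft_disjSum_toRight
  · rintro ⟨P, I⟩ _
    simp
  · intro s _
    rw [Finset.toLeft_disjSum_toRight]

/-- The power series of a geometric series without constant term. -/
noncomputable def positiveGeom : PowerSeries ℚ := PowerSeries.mk fun j => if j = 0 then 0 else 1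

theorem one_sub_X_mul_positiveGeom : (1 - PowerSeries.X) * positiveGeom = PowerSeries.X := by
  ext d
  rcases d with _ | d
  · simp [positiveGeom, sub_mul]
  · rw [sub_mul, one_mul, map_sub, PowerSeries.coeff_succ_X_mul, PowerSeries.coeff_X]
    rcases d with _ | d <;> simp [positiveGeom]

open Classical in
-- Expanding the product chooses a positive multiplicity for each point of `P`.
theorem positiveGeom_pow_card (P : Finset (CubePoint n r)) :
    positiveGeom ^ P.card = PowerSeries.mk fun j =>
      (((Finset.finsuppAntidiag (Finset.univ : Finset (CubePoint n r)) j).filter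
        fun l : CubePoint n r →₀ ℕ => l.support = P).card : ℚ) := by
  ext j
  have h1 : positiveGeom ^ P.card = ∏ p : CubePoint n r, if p ∈ P then positiveGeom else 1 := by
    rw [Finset.prod_ite_mem, Finset.univ_inter, Finset.prod_const]
  rw [h1, PowerSeries.coeff_prod, PowerSeries.coeff_mk, Finset.card_filter, Nat.cast_sum]
  refine Finset.sum_congr rfl fun l _ => ?_
  have h2 : ∀ p, PowerSeries.coeff (l p) (if p ∈ P then positiveGeom else 1) =
      if (p ∈ l.support ↔ p ∈ P) then (1 : ℚ) else 0 := by
    intro p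
    by_cases hp : p ∈ P <;> by_cases hl : l p = 0 <;>
      simp [hp, hl, positiveGeom, PowerSeries.coeff_one]
  simp only [h2]
  rw [Finset.prod_ite_zero]
  simp [Finset.ext_iff]

/-- The lattice vectors of the cone complex at height `j`. -/
def levelSet (n r j : ℕ) : Finset (Fin n → ℕ) :=
  (Fintype.piFinset fun _ : Fin n => Finset.range (j * r + 1)).filter fun x => ∃ i, x i = j * r

theorem mem_levelSet {j : ℕ} {x : Fin n → ℕ} :
    x ∈ levelSet n r j ↔ (∀ i, x i ≤ j * r) ∧ ∃ i, x i = j * r := by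
  simp [levelSet]

theorem combination_mem_levelSet (hn : 0 < n) {j : ℕ} {l : CubePoint n r →₀ ℕ}
    (hl : IsChainSet l.support) (hj : ∑ p, l p = j) : combination l ∈ levelSet n r j := by
  rw [mem_levelSet]
  subst hj
  simp only [combination, Finset.sum_mul]
  refine ⟨fun i => Finset.sum_le_sum fun p _ => Nat.mul_le_mul_left _ (p.le i), ?_⟩
  rcases l.support.eq_empty_or_nonempty with h | h
  · rw [Finsupp.support_eq_empty] at h
    exact ⟨⟨0, hn⟩, by simp [h]⟩
  · obtain ⟨m, hm⟩ := hl.exists_common_max h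
    refine ⟨m, Finset.sum_congr rfl fun p _ => ?_⟩
    by_cases hp : p ∈ l.support
    · rw [hm p hp]
    · rw [Finsupp.notMem_support_iff.1 hp]; simp

theorem card_combination_ne_zero (l : CubePoint n r →₀ ℕ) :
    (Finset.univ.filter fun i => combination l i ≠ 0).card =
      n - (zeroCoords l.support).card := by
  have h : (Finset.univ.filter fun i => combination l i ≠ 0) = (zeroCoords l.support)ᶜ := by
    ext i
    simp only [Finset.mem_filter, Finset.mem_univ, true_and, Finset.mem_compl, mem_zeroCoords,
      combination, ne_eq, Finset.sum_eq_zero_iff, true_implies, mul_eq_zero, Finsupp.mem_support_iff]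
    rw [not_iff_not]
    exact forall_congr' fun p => or_iff_not_imp_left
  rw [h, Finset.card_compl, Fintype.card_fin]

open Classical in
theorem sum_chains_eq_sum_levelSet (hn : 0 < n) (hr : 0 < r) (j : ℕ) (w : ℕ → PowerSeries ℚ) :
    ∑ l ∈ (Finset.finsuppAntidiag (Finset.univ : Finset (CubePoint n r)) j).filter
      (fun l : CubePoint n r →₀ ℕ => IsChainSet l.support), w (n - (zeroCoords l.support).card) =
    ∑ x ∈ levelSet n r j, w (Finset.univ.filter fun i => x i ≠ 0).card := by
  refine Finset.sum_nbij combination ?_ ?_ ?_ ?_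
  · intro l hl
    simp only [Finset.mem_filter, Finset.mem_finsuppAntidiag] at hl
    exact combination_mem_levelSet hn hl.2 hl.1.1
  · intro l hl l' hl' h
    exact combination_injOn hn hr (Finset.mem_filter.1 hl).2 (Finset.mem_filter.1 hl').2 h
  · intro x hx
    obtain ⟨hx1, hx2⟩ := mem_levelSet.1 (Finset.mem_coe.1 hx)
    -- Height zero contains only the empty combination; the rounding construction divides by `j`.
    rcases Nat.eq_zero_or_pos j with rfl | hj
    · refine ⟨0, by simp [IsChainSet], ?_⟩
      ext i
      have := hx1 i
      simp only [combination, Finsupp.coe_zero, Pi.zero_apply, zero_mul, Finset.sum_const_zero]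
      omega
    · obtain ⟨l, hl1, hl2, hl3⟩ := exists_combination_eq hj x hx1 hx2
      exact ⟨l, by simp [hl1, hl2], hl3⟩
  · intro l _
    rw [card_combination_ne_zero]

theorem sum_piFinset_range (N : ℕ) (y : PowerSeries ℚ) :
    ∑ x ∈ Fintype.piFinset (fun _ : Fin n => Finset.range (N + 1)),
      y ^ (Finset.univ.filter fun i => x i ≠ 0).card = (1 + N * y) ^ n := by
  have h1 : ∀ x : Fin n → ℕ, y ^ (Finset.univ.filter fun i => x i ≠ 0).card =
      ∏ i, if x i ≠ 0 then y else 1 := by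
    intro x
    rw [Finset.prod_ite]
    simp
  simp only [h1]
  rw [← Finset.prod_univ_sum (fun _ : Fin n => Finset.range (N + 1))
    (fun _ k => if k ≠ 0 then y else 1)]
  simp only [Finset.prod_const, Finset.card_univ, Fintype.card_fin]
  congr 1
  rw [Finset.sum_range_succ']
  simp [add_comm]

/-- The level set is a cube minus the cube with side one smaller, and over a cube the weight factors
through the coordinates. -/
theorem sum_levelSet (hr : 0 < r) (j : ℕ) (y : PowerSeries ℚ) :
    ∑ x ∈ levelSet n r (j + 1), y ^ (Finset.univ.filter fun i => x i ≠ 0).card =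
      (1 + (j + 1 : ℕ) * r * y) ^ n - (1 - y + (j + 1 : ℕ) * r * y) ^ n := by
  have hpos : 0 < (j + 1) * r := Nat.mul_pos (Nat.succ_pos j) hr
  have h1 := sum_piFinset_range (n := n) ((j + 1) * r) y
  have h2 := sum_piFinset_range (n := n) ((j + 1) * r - 1) y
  rw [Nat.sub_add_cancel hpos] at h2
  rw [← Finset.sum_filter_add_sum_filter_not _ (fun x => ∃ i, x i = (j + 1) * r)] at h1
  have h3 : (Fintype.piFinset fun _ : Fin n => Finset.range ((j + 1) * r + 1)).filter
      (fun x => ¬ ∃ i, x i = (j + 1) * r) =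
      Fintype.piFinset fun _ : Fin n => Finset.range ((j + 1) * r) := by
    ext x
    simp only [Finset.mem_filter, Fintype.mem_piFinset, Finset.mem_range, not_exists]
    rw [← forall_and]
    exact forall_congr' fun i => by omega
  rw [h3, h2] at h1
  change ∑ x ∈ levelSet n r (j + 1), _ + _ = _ at h1
  rw [eq_sub_iff_add_eq]
  refine Eq.trans ?_ (h1.trans ?_)
  · congr 2
    rw [Nat.cast_sub hpos]
    push_cast
    ring
  · push_cast
    rfl

theorem sum_levelSet_zero (hn : 0 < n) (y : PowerSeries ℚ) :
    ∑ x ∈ levelSet n r 0, y ^ (Finset.univ.filter fun i => x i ≠ 0).card = 1 := by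
  have : levelSet n r 0 = {0} := by
    ext x
    rw [mem_levelSet, Finset.mem_singleton]
    constructor
    · rintro ⟨h, -⟩
      ext i
      simpa using h i
    · rintro rfl
      exact ⟨by simp, ⟨0, hn⟩, by simp⟩
  simp [this]

/-- The difference of powers whose generating function is the `h`-polynomial. -/
noncomputable def powDiff (n r j : ℕ) : PowerSeries ℚ :=
  (1 + (j : PowerSeries ℚ) * (r : PowerSeries ℚ) * (1 - PowerSeries.X)) ^ n -
    (PowerSeries.X + (j : PowerSeries ℚ) * (r : PowerSeries ℚ) * (1 - PowerSeries.X)) ^ n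

open Classical in
-- Writing `X ^ |P|` as `((1 - X) * positiveGeom) ^ |P|` turns a chain set into all multisets
-- supported on it, which correspond to lattice vectors; the exponent of `1 - X` becomes the number
-- of nonzero coordinates.
theorem toSeries_sum_chains (hn : 0 < n) (hr : 0 < r) :
    toSeries (∑ P ∈ (Finset.univ : Finset (Finset (CubePoint n r))).filter IsChainSet,
      X ^ P.card * (1 - X) ^ (n - P.card - (zeroCoords P).card)) =
    PowerSeries.X ^ n + PowerSeries.shiftSum (powDiff n r) := by
  have h1 : ∀ P ∈ (Finset.univ : Finset (Finset (CubePoint n r))).filter IsChainSet,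
      toSeries (X ^ P.card * (1 - X) ^ (n - P.card - (zeroCoords P).card)) =
      PowerSeries.shiftSum fun j => ∑ l ∈ (Finset.finsuppAntidiag
        (Finset.univ : Finset (CubePoint n r)) j).filter (fun l : CubePoint n r →₀ ℕ => l.support = P),
        (1 - PowerSeries.X) ^ (n - (zeroCoords l.support).card) := by
    intro P hP
    have hcard := card_add_card_zeroCoords_le hn hr (Finset.mem_filter.1 hP).2
    have h2 : ∀ j, ∑ l ∈ (Finset.finsuppAntidiag
        (Finset.univ : Finset (CubePoint n r)) j).filter (fun l : CubePoint n r →₀ ℕ => l.support = P),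
        (1 - PowerSeries.X : PowerSeries ℚ) ^ (n - (zeroCoords l.support).card) =
        (1 - PowerSeries.X) ^ (n - (zeroCoords P).card) *
        (((Finset.finsuppAntidiag (Finset.univ : Finset (CubePoint n r)) j).filter
        fun l : CubePoint n r →₀ ℕ => l.support = P).card : PowerSeries ℚ) := by
      intro j
      rw [Finset.sum_congr rfl (g := fun _ =>
        (1 - PowerSeries.X : PowerSeries ℚ) ^ (n - (zeroCoords P).card))]
      · rw [Finset.sum_const, nsmul_eq_mul, mul_comm]
      · intro l hl
        rw [(Finset.mem_filter.1 hl).2]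
    simp only [h2]
    rw [PowerSeries.shiftSum_mul_left, PowerSeries.shiftSum_natCast, ← positiveGeom_pow_card,
      map_mul, map_pow, map_pow, map_sub, map_one, toSeries_X]
    have h3 : n - (zeroCoords P).card = (n - P.card - (zeroCoords P).card) + P.card := by omega
    rw [h3, pow_add, mul_assoc, ← mul_pow, one_sub_X_mul_positiveGeom, mul_comm]
  rw [map_sum, Finset.sum_congr rfl h1, ← PowerSeries.shiftSum_sum]
  have h4 : ∀ j, ∑ P ∈ (Finset.univ : Finset (Finset (CubePoint n r))).filter IsChainSet,
      ∑ l ∈ (Finset.finsuppAntidiag (Finset.univ : Finset (CubePoint n r)) j).filter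
        (fun l : CubePoint n r →₀ ℕ => l.support = P),
        (1 - PowerSeries.X : PowerSeries ℚ) ^ (n - (zeroCoords l.support).card) =
      ∑ x ∈ levelSet n r j, (1 - PowerSeries.X) ^ (Finset.univ.filter fun i => x i ≠ 0).card := by
    intro j
    rw [← sum_chains_eq_sum_levelSet hn hr j fun k => (1 - PowerSeries.X) ^ k,
      ← Finset.sum_fiberwise_of_maps_to (t := Finset.univ.filter IsChainSet)
        (g := fun l : CubePoint n r →₀ ℕ => l.support)]
    · refine Finset.sum_congr rfl fun P hP => Finset.sum_congr ?_ fun _ _ => rfl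
      ext l
      simp only [Finset.mem_filter]
      constructor
      · rintro ⟨h, rfl⟩
        exact ⟨⟨h, (Finset.mem_filter.1 hP).2⟩, rfl⟩
      · rintro ⟨⟨h, -⟩, h'⟩
        exact ⟨h, h'⟩
    · intro l hl
      simpa using (Finset.mem_filter.1 hl).2
  simp only [h4]
  rw [PowerSeries.shiftSum_eq, PowerSeries.shiftSum_eq (powDiff n r), sum_levelSet_zero hn]
  -- At height zero the count is `1` while `powDiff` gives `1 - X ^ n`; this is the source of the
  -- extra `X ^ n`.
  have h5 : powDiff n r 0 = 1 - PowerSeries.X ^ n := by simp [powDiff]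
  have h6 : (fun j => ∑ x ∈ levelSet n r (j + 1),
      (1 - PowerSeries.X : PowerSeries ℚ) ^ (Finset.univ.filter fun i => x i ≠ 0).card) =
      fun j => powDiff n r (j + 1) := by
    ext1 j
    rw [sum_levelSet hr, powDiff, sub_sub_cancel]
  rw [h5, h6]
  ring

/-- There is a flag simplicial polytope whose `h`-polynomial is an explicit power series. -/
theorem exists_polytope (hn : 0 < n) (hr : 0 < r) :
    ∃ P : Set (EuclideanSpace ℝ (Fin n)), IsSimplicialPolytope n P ∧ (boundaryComplex P).IsFlag ∧
      toSeries ((boundaryComplex P).hPolynomial n) =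
        PowerSeries.X ^ n + PowerSeries.shiftSum (powDiff n r) := by
  classical
  obtain ⟨φ, -, h⟩ := exists_isCliqueRealization (n := n) (r := r) hn hr
  have : Nonempty (Vertex n r) := ⟨.inr ⟨0, hn⟩⟩
  have hfin : Module.finrank ℝ (EuclideanSpace ℝ (Fin n)) = n := finrank_euclideanSpace_fin
  refine ⟨_, ?_, h.isFlag_boundaryComplex, ?_⟩
  · have := h.isSimplicialPolytope
    rwa [hfin] at this
  · have := h.hPolynomial_eq
    rw [hfin] at this
    rw [this, ← toSeries_sum_chains hn hr, ← sum_cliques_eq hn hr]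
    congr!

end CubePoint

/-! ### Descents under insertion of the largest letter, and the Carlitz identity. -/

namespace ColoredPerm

variable {r n : ℕ}

/-- Insert the largest letter, with color `c`, at position `k` of a permutation. -/
def insertMaxPerm (k : Fin (n + 1)) (σ : Equiv.Perm (Fin n)) : Equiv.Perm (Fin (n + 1)) :=
  ((finSuccEquiv' k).trans (Equiv.optionCongr σ)).trans (finSuccEquiv' (Fin.last n)).symm

@[simp]
theorem insertMaxPerm_self (k : Fin (n + 1)) (σ : Equiv.Perm (Fin n)) :
    insertMaxPerm k σ k = Fin.last n := by
  simp [insertMaxPerm]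

@[simp]
theorem insertMaxPerm_succAbove (k : Fin (n + 1)) (σ : Equiv.Perm (Fin n)) (i : Fin n) :
    insertMaxPerm k σ (k.succAbove i) = (σ i).castSucc := by
  simp [insertMaxPerm]

/-- Insert the largest letter, with color `c`, at position `k` of a colored permutation. -/
def insertMax (k : Fin (n + 1)) (c : Fin r) (w : ColoredPerm r n) : ColoredPerm r (n + 1) :=
  (insertMaxPerm k w.1, k.insertNth (α := fun _ => Fin r) c w.2)

theorem insertMax_bijective :
    Function.Bijective fun z : Fin (n + 1) × Fin r × ColoredPerm r n =>
      insertMax z.1 z.2.1 z.2.2 := by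
  rw [Fintype.bijective_iff_injective_and_card]
  constructor
  · rintro ⟨k, c, σ, ε⟩ ⟨k', c', σ', ε'⟩ h
    obtain ⟨h1, h2⟩ := Prod.ext_iff.1 h
    simp only [insertMax] at h1 h2
    have hk : k = k' := by
      apply (insertMaxPerm k' σ').injective
      rw [← h1, insertMaxPerm_self, h1, insertMaxPerm_self]
    subst hk
    have hσ : σ = σ' := by
      ext i
      have := congrArg (fun τ : Equiv.Perm (Fin (n + 1)) => (τ (k.succAbove i)).val) h1
      simpa using this
    subst hσ
    have hc : c = c' := by
      have := congrFun h2 k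
      simpa using this
    have hε : ε = ε' := by
      ext i
      have := congrFun h2 (k.succAbove i)
      simpa using congrArg Fin.val this
    rw [hc, hε]
  · simp only [Fintype.card_prod, Fintype.card_fin, Fintype.card_perm, Fintype.card_fun,
      Nat.factorial_succ, pow_succ]
    ring

theorem letter_lt (w : ColoredPerm r n) {k : ℕ} (hk : k < n) : w.letter k < n := by
  rw [letter, dif_pos hk]
  exact (w.1 _).2

theorem letter_of_le (w : ColoredPerm r n) {k : ℕ} (hk : n ≤ k) : w.letter k = n := by
  rw [letter, dif_neg (not_lt.2 hk)]

theorem color_of_le (w : ColoredPerm r n) {k : ℕ} (hk : n ≤ k) : w.color k = 0 := by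
  rw [color, dif_neg (not_lt.2 hk)]

theorem color_le (w : ColoredPerm r n) {k : ℕ} : w.color k ≤ r := by
  rw [color]
  split_ifs
  · exact (w.2 _).2.le
  · exact Nat.zero_le _

theorem color_insertMax (k : Fin (n + 1)) (c : Fin r) (w : ColoredPerm r n) (i : ℕ) :
    (insertMax k c w).color i =
      if i < k then w.color i else if i = k then (c : ℕ) else w.color (i - 1) := by
  have hk := k.2
  rcases lt_trichotomy i (k : ℕ) with h | h | h
  · rw [if_pos h]
    have hi : i < n := by omega
    have : (⟨i, by omega⟩ : Fin (n + 1)) = k.succAbove ⟨i, hi⟩ := by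
      rw [Fin.succAbove_of_castSucc_lt _ _ (by simpa [Fin.lt_def] using h)]
      rfl
    rw [color, dif_pos (by omega), color, dif_pos hi, this]
    simp [insertMax]
  · rw [if_neg (by omega), if_pos h]
    have : (⟨i, by omega⟩ : Fin (n + 1)) = k := Fin.ext h
    rw [color, dif_pos (by omega), this]
    simp [insertMax]
  · rw [if_neg (by omega), if_neg (by omega)]
    by_cases hi : i < n + 1
    · have : (⟨i, hi⟩ : Fin (n + 1)) = k.succAbove ⟨i - 1, by omega⟩ := by
        rw [Fin.succAbove_of_le_castSucc _ _ (by rw [Fin.le_def]; simp; omega)]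
        ext
        simp
        omega
      rw [color, dif_pos hi, color, dif_pos (by omega), this]
      simp [insertMax]
    · rw [color_of_le _ (by omega), color_of_le _ (by omega)]

theorem letter_insertMax (k : Fin (n + 1)) (c : Fin r) (w : ColoredPerm r n) (i : ℕ) :
    (insertMax k c w).letter i =
      if i < k then w.letter i else if i = k then n
        else if i ≤ n then w.letter (i - 1) else n + 1 := by
  have hk := k.2
  rcases lt_trichotomy i (k : ℕ) with h | h | h
  · rw [if_pos h]
    have hi : i < n := by omega
    have : (⟨i, by omega⟩ : Fin (n + 1)) = k.succAbove ⟨i, hi⟩ := by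
      rw [Fin.succAbove_of_castSucc_lt _ _ (by simpa [Fin.lt_def] using h)]
      rfl
    rw [letter, dif_pos (by omega), letter, dif_pos hi, this]
    simp [insertMax]
  · rw [if_neg (by omega), if_pos h]
    have : (⟨i, by omega⟩ : Fin (n + 1)) = k := Fin.ext h
    rw [letter, dif_pos (by omega), this]
    simp [insertMax]
  · rw [if_neg (by omega), if_neg (by omega)]
    by_cases hi : i < n + 1
    · have : (⟨i, hi⟩ : Fin (n + 1)) = k.succAbove ⟨i - 1, by omega⟩ := by
        rw [Fin.succAbove_of_le_castSucc _ _ (by rw [Fin.le_def]; simp; omega)]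
        ext
        simp
        omega
      rw [letter, dif_pos hi, if_pos (by omega), letter, dif_pos (by omega), this]
      simp [insertMax]
    · rw [letter_of_le _ (by omega), if_neg (by omega)]

/-- `k` is a descent. -/
def IsDescent (w : ColoredPerm r n) (k : ℕ) : Prop :=
  w.color (k + 1) < w.color k ∨ (w.color k = w.color (k + 1) ∧ w.letter (k + 1) < w.letter k)

instance (w : ColoredPerm r n) : DecidablePred w.IsDescent := fun k => by
  unfold IsDescent; infer_instance

theorem des_eq_sum (w : ColoredPerm r n) :
    (w.des : ℤ) = ∑ k ∈ Finset.range n, if w.IsDescent k then (1 : ℤ) else 0 := by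
  rw [des, Finset.card_filter]
  push_cast
  rfl

theorem isDescent_insertMax_of_lt {k : Fin (n + 1)} {c : Fin r} {w : ColoredPerm r n} {i : ℕ}
    (h : i + 1 < k) : (insertMax k c w).IsDescent i ↔ w.IsDescent i := by
  simp only [IsDescent, color_insertMax, letter_insertMax, if_pos h,
    if_pos (show i < (k : ℕ) by omega)]

theorem isDescent_insertMax_of_gt {k : Fin (n + 1)} {c : Fin r} {w : ColoredPerm r n} {i : ℕ}
    (h : k ≤ i) (hi : i < n) : (insertMax k c w).IsDescent (i + 1) ↔ w.IsDescent i := by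
  simp only [IsDescent, color_insertMax, letter_insertMax,
    if_neg (show ¬ i + 1 + 1 < (k : ℕ) by omega),
    if_neg (show ¬ i + 1 < (k : ℕ) by omega), if_neg (show ¬ i + 1 = (k : ℕ) by omega),
    if_neg (show ¬ i + 1 + 1 = (k : ℕ) by omega), Nat.add_sub_cancel,
    if_pos (show i + 1 ≤ n by omega)]
  have h1 := w.letter_lt hi
  -- In the last position the final convention letter changes from `n` to `n + 1`, but both exceed
  -- every actual letter.
  split_ifs with h2
  · rfl
  · rw [w.letter_of_le (show n ≤ i + 1 by omega)]
    omega

theorem isDescent_insertMax_pred {k : Fin (n + 1)} {c : Fin r} {w : ColoredPerm r n} {i : ℕ}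
    (h : i + 1 = k) : (insertMax k c w).IsDescent i ↔ (c : ℕ) < w.color i := by
  have hk := k.2
  simp only [IsDescent, color_insertMax, letter_insertMax,
    if_neg (show ¬ i + 1 < (k : ℕ) by omega),
    if_pos (show i < (k : ℕ) by omega), if_pos h]
  have h1 := w.letter_lt (show i < n by omega)
  omega

theorem isDescent_insertMax_self {k : Fin (n + 1)} {c : Fin r} {w : ColoredPerm r n} :
    (insertMax k c w).IsDescent k ↔ if (k : ℕ) < n then w.color k ≤ c else 0 < (c : ℕ) := by
  have hk := k.2
  simp only [IsDescent, color_insertMax, letter_insertMax,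
    if_neg (show ¬ (k : ℕ) + 1 < (k : ℕ) by omega),
    if_neg (show ¬ (k : ℕ) + 1 = (k : ℕ) by omega), if_neg (lt_irrefl (k : ℕ)), if_true,
    Nat.add_sub_cancel]
  split_ifs with h h' h'
  · have h1 := w.letter_lt h'
    omega
  · omega
  · omega
  · rw [w.color_of_le (by omega)]
    omega

/-- The increase of the number of descents under `insertMax`. -/
def desIncr (w : ColoredPerm r n) (k : ℕ) (c : Fin r) : ℤ :=
  (if k = 0 then 0 else (if (c : ℕ) < w.color (k - 1) then 1 else 0) -
    if w.IsDescent (k - 1) then 1 else 0) +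
  if k < n then (if w.color k ≤ c then 1 else 0) else if 0 < (c : ℕ) then 1 else 0

theorem des_insertMax (k : Fin (n + 1)) (c : Fin r) (w : ColoredPerm r n) :
    ((insertMax k c w).des : ℤ) = w.des + desIncr w k c := by
  have hk := k.2
  rw [des_eq_sum, des_eq_sum]
  have hself : (if (insertMax k c w).IsDescent k then (1 : ℤ) else 0) =
      if (k : ℕ) < n then (if w.color k ≤ c then 1 else 0) else if 0 < (c : ℕ) then 1 else 0 := by
    rw [if_congr isDescent_insertMax_self rfl rfl]
    split_ifs <;> rfl
  rcases Nat.eq_zero_or_pos (k : ℕ) with h0 | hpos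
  · rw [Finset.sum_range_succ']
    rw [Finset.sum_congr rfl fun i hi => if_congr
      (isDescent_insertMax_of_gt (by omega) (Finset.mem_range.1 hi)) rfl rfl]
    have h1 : (0 : ℕ) = (k : ℕ) := h0.symm
    rw [desIncr, if_pos h0, ← hself, zero_add, h0]
  · obtain ⟨a, ha⟩ : ∃ a, (k : ℕ) = a + 1 := ⟨k - 1, by omega⟩
    obtain ⟨b, hb⟩ : ∃ b, n = a + 1 + b := ⟨n - a - 1, by omega⟩
    have e1 : Finset.range (n + 1) = Finset.range (a + 1 + 1 + b) := by congr 1; omega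
    have e2 : Finset.range n = Finset.range (a + 1 + b) := by congr 1
    rw [e1, e2, Finset.sum_range_add, Finset.sum_range_succ, Finset.sum_range_succ,
      Finset.sum_range_add, Finset.sum_range_succ]
    rw [Finset.sum_congr rfl fun i hi => if_congr
      (isDescent_insertMax_of_lt (by have := Finset.mem_range.1 hi; omega)) rfl rfl]
    rw [Finset.sum_congr (s₁ := Finset.range b) rfl (g := fun i =>
      if w.IsDescent (a + 1 + i) then (1 : ℤ) else 0) fun i hi => by
        rw [show a + 1 + 1 + i = a + 1 + i + 1 by omega]
        exact if_congr (isDescent_insertMax_of_gt (by omega)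
          (by have := Finset.mem_range.1 hi; omega)) rfl rfl]
    rw [if_congr (isDescent_insertMax_pred ha.symm) rfl rfl, ← ha, hself, desIncr,
      if_neg hpos.ne', ha, Nat.add_sub_cancel]
    ring

/-- Across a descent the colors weakly decrease, so any inserted color creates a descent on at least
one side, making up for the lost one; across an ascent it cannot create two. -/
theorem desIncr_eq_zero_or_one (w : ColoredPerm r n) {k : ℕ} (hk : k ≤ n) (c : Fin r) :
    desIncr w k c = 0 ∨ desIncr w k c = 1 := by
  unfold desIncr
  rcases k with _ | k
  · simp only [if_true]
    split_ifs <;> simp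
  · rw [if_neg (Nat.succ_ne_zero k), Nat.add_sub_cancel]
    have h1 : w.IsDescent k → (c : ℕ) < w.color k ∨
        if k + 1 < n then w.color (k + 1) ≤ c else 0 < (c : ℕ) := by
      intro h
      have hle : w.color (k + 1) ≤ w.color k := by
        rcases h with h | h
        · exact h.le
        · exact h.1.ge
      split_ifs with hkn
      · omega
      · have hz := w.color_of_le (show n ≤ k + 1 by omega)
        have hl := w.letter_of_le (show n ≤ k + 1 by omega)
        have hl' := w.letter_lt (show k < n by omega)
        rcases h with h | h <;> omega
    have h2 : ¬ w.IsDescent k → ¬ ((c : ℕ) < w.color k ∧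
        if k + 1 < n then w.color (k + 1) ≤ c else 0 < (c : ℕ)) := by
      rintro h ⟨h3, h4⟩
      apply h
      left
      split_ifs at h4 with hkn
      · omega
      · have hz := w.color_of_le (show n ≤ k + 1 by omega)
        omega
    by_cases hd : w.IsDescent k
    · have := h1 hd
      split_ifs at this ⊢ <;> simp_all
    · have := h2 hd
      split_ifs at this ⊢ <;> simp_all

theorem sum_fin_lt (m : ℕ) (hm : m ≤ r) :
    ∑ c : Fin r, (if (c : ℕ) < m then (1 : ℤ) else 0) = m := by
  rw [Fin.sum_univ_eq_sum_range (fun c => if c < m then (1 : ℤ) else 0) r, ← Finset.sum_filter]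
  have : (Finset.range r).filter (fun c => c < m) = Finset.range m := by
    ext c
    simp only [Finset.mem_filter, Finset.mem_range]
    omega
  simp [this]

theorem sum_fin_ge (m : ℕ) (hm : m ≤ r) :
    ∑ c : Fin r, (if m ≤ (c : ℕ) then (1 : ℤ) else 0) = r - m := by
  have h1 : ∀ c : Fin r, (if m ≤ (c : ℕ) then (1 : ℤ) else 0) =
      1 - if (c : ℕ) < m then 1 else 0 := by
    intro c
    split_ifs <;> first | rfl | omega
  simp only [h1, Finset.sum_sub_distrib, sum_fin_lt m hm]
  simp

/-- The letter at `k` gives `w.color k` descents when the insertion is just after it and `r -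
w.color k` when just before, so the colors cancel. The last position adds `r - 1`, and each old
descent is lost for `r` colors. -/
theorem sum_desIncr (hr : 0 < r) (w : ColoredPerm r n) :
    ∑ k : Fin (n + 1), ∑ c : Fin r, desIncr w k c = r * n + r - 1 - r * w.des := by
  rw [Fin.sum_univ_eq_sum_range (fun k => ∑ c : Fin r, desIncr w k c) (n + 1)]
  simp only [desIncr, Finset.sum_add_distrib]
  rw [Finset.sum_range_succ', Finset.sum_range_succ]
  have h1 : ∀ k ∈ Finset.range n, ∑ c : Fin r, (if k + 1 = 0 then (0 : ℤ) else
      (if (c : ℕ) < w.color (k + 1 - 1) then 1 else 0) -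
        if w.IsDescent (k + 1 - 1) then 1 else 0) =
      w.color k - r * if w.IsDescent k then 1 else 0 := by
    intro k _
    simp only [Nat.succ_ne_zero, if_false, Nat.add_sub_cancel, Finset.sum_sub_distrib]
    rw [sum_fin_lt _ w.color_le]
    simp
  have h2 : ∀ k ∈ Finset.range n, ∑ c : Fin r, (if k < n then
      (if w.color k ≤ c then (1 : ℤ) else 0) else if 0 < (c : ℕ) then 1 else 0) =
      r - w.color k := by
    intro k hk
    simp only [if_pos (Finset.mem_range.1 hk)]
    exact sum_fin_ge _ w.color_le
  rw [Finset.sum_congr rfl h1, Finset.sum_congr rfl h2, Finset.sum_sub_distrib,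
    Finset.sum_sub_distrib, ← Finset.mul_sum, ← des_eq_sum]
  simp only [lt_irrefl, if_false, if_true, Finset.sum_const_zero]
  have h3 := sum_fin_ge (r := r) 1 hr
  simp only [Nat.succ_le_iff] at h3
  rw [h3]
  simp
  ring

end ColoredPerm

/-- Of the `(n + 1) * r` insertions into `w`, exactly `r * n + r - 1 - r * w.des` raise the descent
number by one and the others keep it; the factor `w.des` becomes the derivative. -/
theorem coloredEulerian_succ (n r : ℕ) (hr : 0 < r) :
    coloredEulerian (n + 1) r =
      (1 + (r * n + r - 1 : ℤ[X]) * X) * coloredEulerian n r +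
        (r : ℤ[X]) * X * (1 - X) * derivative (coloredEulerian n r) := by
  have h1 : coloredEulerian (n + 1) r = ∑ w : ColoredPerm r n, ∑ k : Fin (n + 1), ∑ c : Fin r,
      X ^ (ColoredPerm.insertMax k c w).des := by
    unfold coloredEulerian
    rw [← Function.Bijective.sum_comp (ColoredPerm.insertMax_bijective (n := n) (r := r))
      (fun w => (X : ℤ[X]) ^ w.des)]
    rw [Fintype.sum_prod_type]
    simp only [Fintype.sum_prod_type (α₁ := Fin r)]
    rw [Finset.sum_congr rfl fun k _ => Finset.sum_comm, Finset.sum_comm]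
  have h2 : ∀ (w : ColoredPerm r n) (k : Fin (n + 1)) (c : Fin r),
      (X : ℤ[X]) ^ (ColoredPerm.insertMax k c w).des =
        X ^ w.des + C (ColoredPerm.desIncr w k c) * (X ^ (w.des + 1) - X ^ w.des) := by
    intro w k c
    have h3 := ColoredPerm.des_insertMax k c w
    rcases ColoredPerm.desIncr_eq_zero_or_one w (Nat.lt_succ_iff.1 k.2) c with h | h
    · rw [h] at h3 ⊢
      have : (ColoredPerm.insertMax k c w).des = w.des := by omega
      rw [this]
      simp
    · rw [h] at h3 ⊢
      have : (ColoredPerm.insertMax k c w).des = w.des + 1 := by omega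
      rw [this]
      simp
  have h4 : ∀ w : ColoredPerm r n, ∑ k : Fin (n + 1), ∑ c : Fin r,
      (X : ℤ[X]) ^ (ColoredPerm.insertMax k c w).des =
      ((n : ℤ[X]) + 1) * (r : ℤ[X]) * X ^ w.des +
        ((r : ℤ[X]) * (n : ℤ[X]) + (r : ℤ[X]) - 1 - (r : ℤ[X]) * (w.des : ℤ[X])) *
          (X ^ (w.des + 1) - X ^ w.des) := by
    intro w
    simp only [h2, Finset.sum_add_distrib, ← Finset.sum_mul, ← map_sum]
    rw [ColoredPerm.sum_desIncr hr w]
    simp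
    ring
  have h5 : X * derivative (coloredEulerian n r) =
      ∑ w : ColoredPerm r n, (w.des : ℤ[X]) * X ^ w.des := by
    rw [coloredEulerian, derivative_sum, Finset.mul_sum]
    refine Finset.sum_congr rfl fun w _ => ?_
    rcases w.des with _ | d
    · simp
    · rw [derivative_X_pow]
      simp
      ring
  have h6 : (r : ℤ[X]) * X * (1 - X) * derivative (coloredEulerian n r) =
      (r : ℤ[X]) * (1 - X) * (X * derivative (coloredEulerian n r)) := by ring
  rw [h1, h6, h5, coloredEulerian, Finset.mul_sum, Finset.mul_sum, ← Finset.sum_add_distrib]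
  refine Finset.sum_congr rfl fun w _ => ?_
  rw [h4]
  ring

theorem coloredEulerian_zero (r : ℕ) : coloredEulerian 0 r = 1 := by
  simp [coloredEulerian, ColoredPerm.des]

/-- Carlitz identity for colored permutations, in terms of formal power series. -/
theorem toSeries_coloredEulerian (n r : ℕ) (hr : 0 < r) :
    toSeries (coloredEulerian n r) = (1 - PowerSeries.X) ^ (n + 1) *
      PowerSeries.mk fun j => ((r * j + 1 : ℕ) : ℚ) ^ n := by
  induction n with
  | zero =>
    rw [coloredEulerian_zero, map_one]
    simp only [pow_zero, zero_add, pow_one]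
    have : (PowerSeries.mk fun _ => (1 : ℚ)) = PowerSeries.mk 1 := rfl
    rw [this, mul_comm]
    exact (PowerSeries.mk_one_mul_one_sub_eq_one ℚ).symm
  | succ n ih =>
    set S : PowerSeries ℚ := PowerSeries.mk fun j => ((r * j + 1 : ℕ) : ℚ) ^ n with hS
    have hder : toSeries (derivative (coloredEulerian n r)) =
        PowerSeries.derivative ℚ (toSeries (coloredEulerian n r)) := by
      change ((Polynomial.map (Int.castRingHom ℚ) (derivative (coloredEulerian n r)) : ℚ[X]) :
        PowerSeries ℚ) = PowerSeries.derivative ℚ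
          ((Polynomial.map (Int.castRingHom ℚ) (coloredEulerian n r) : ℚ[X]) : PowerSeries ℚ)
      rw [PowerSeries.derivative_coe, Polynomial.derivative_map]
    -- Multiplying the coefficient by `r * j + 1` is the operator `1 + r X d/dX`, which the
    -- recurrence realizes after conjugation by a power of `1 - X`.
    have hS' : (PowerSeries.mk fun j => ((r * j + 1 : ℕ) : ℚ) ^ (n + 1)) =
        S + (r : PowerSeries ℚ) * PowerSeries.X * PowerSeries.derivative ℚ S := by
      ext d
      have hrC : (r : PowerSeries ℚ) = PowerSeries.C (r : ℚ) := by simp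
      rw [map_add, hrC, mul_assoc, PowerSeries.coeff_C_mul]
      rcases d with _ | d
      · simp [hS]
      · rw [PowerSeries.coeff_succ_X_mul, PowerSeries.coeff_derivative, hS]
        simp only [PowerSeries.coeff_mk]
        push_cast
        ring
    have hD : PowerSeries.derivative ℚ ((1 - PowerSeries.X) ^ (n + 1) * S) =
        (1 - PowerSeries.X) ^ (n + 1) * PowerSeries.derivative ℚ S -
          ((n : PowerSeries ℚ) + 1) * (1 - PowerSeries.X) ^ n * S := by
      rw [Derivation.leibniz, PowerSeries.derivative_pow]
      simp
      ring
    rw [coloredEulerian_succ n r hr, map_add, map_mul, map_mul, hder, ih, hS', hD]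
    simp only [map_add, map_sub, map_mul, map_one, map_natCast, toSeries_X]
    ring

/-! ### Cones of `γ`-positive polynomials, with integer centers so that `-1` is allowed. -/

/-- The additive monoid spanned by `t ^ i * (1 + t) ^ j` with `2 * i + j = c`. -/
noncomputable def gammaMonoid (c : ℤ) : AddSubmonoid ℤ[X] :=
  AddSubmonoid.closure {f | ∃ i j : ℕ, 2 * (i : ℤ) + j = c ∧ f = X ^ i * (1 + X) ^ j}

theorem mul_mem_gammaMonoid {c d : ℤ} {f g : ℤ[X]} (hf : f ∈ gammaMonoid c)
    (hg : g ∈ gammaMonoid d) : f * g ∈ gammaMonoid (c + d) := by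
  induction hf using AddSubmonoid.closure_induction with
  | zero => rw [zero_mul]; exact zero_mem _
  | add x y _ _ hx hy => rw [add_mul]; exact add_mem hx hy
  | mem x hx =>
    obtain ⟨i, j, rfl, rfl⟩ := hx
    induction hg using AddSubmonoid.closure_induction with
    | zero => rw [mul_zero]; exact zero_mem _
    | add x y _ _ hx hy => rw [mul_add]; exact add_mem hx hy
    | mem y hy =>
      obtain ⟨k, l, rfl, rfl⟩ := hy
      exact AddSubmonoid.subset_closure ⟨i + k, j + l, by push_cast; ring, by ring⟩

theorem one_mem_gammaMonoid : (1 : ℤ[X]) ∈ gammaMonoid 0 :=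
  AddSubmonoid.subset_closure ⟨0, 0, by simp, by simp⟩

theorem natCast_mem_gammaMonoid (m : ℕ) : (m : ℤ[X]) ∈ gammaMonoid 0 := by
  rw [← nsmul_one]
  exact nsmul_mem one_mem_gammaMonoid m

theorem X_mem_gammaMonoid : (X : ℤ[X]) ∈ gammaMonoid 2 :=
  AddSubmonoid.subset_closure ⟨1, 0, by simp, by simp⟩

theorem one_add_X_mem_gammaMonoid : (1 + X : ℤ[X]) ∈ gammaMonoid 1 :=
  AddSubmonoid.subset_closure ⟨0, 1, by simp, by simp⟩

theorem isGammaPositive_of_mem {c : ℕ} {f : ℤ[X]} (hf : f ∈ gammaMonoid c) :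
    IsGammaPositive c f := by
  induction hf using AddSubmonoid.closure_induction with
  | zero => exact ⟨0, by simp⟩
  | add x y _ _ hx hy =>
    obtain ⟨γ, rfl⟩ := hx
    obtain ⟨δ, rfl⟩ := hy
    refine ⟨γ + δ, ?_⟩
    rw [← Finset.sum_add_distrib]
    refine Finset.sum_congr rfl fun i _ => ?_
    simp only [Pi.add_apply, Nat.cast_add]
    ring
  | mem x hx =>
    obtain ⟨i, j, hij, rfl⟩ := hx
    refine ⟨Pi.single i 1, ?_⟩
    have hc : c = 2 * i + j := by omega
    rw [Finset.sum_eq_single i]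
    · rw [Pi.single_eq_same, Nat.cast_one, one_mul, hc, Nat.add_sub_cancel_left]
    · intro k _ hk
      simp [hk]
    · intro hi
      exact absurd (Finset.mem_range.2 (by omega)) hi

/-! ### Exponential generating functions and `γ`-positivity from differential equations. -/

namespace ExpGenFun

section Coefficients

variable {A : Type*} [CommRing A]

/-- The coefficients of an exponential generating function. -/
noncomputable def ec (n : ℕ) (F : PowerSeries A) : A :=
  (n.factorial : A) * PowerSeries.coeff n F

theorem ec_zero (F : PowerSeries A) : ec 0 F = PowerSeries.constantCoeff F := by simp [ec]

theorem ec_add (n : ℕ) (F G : PowerSeries A) : ec n (F + G) = ec n F + ec n G := by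
  simp [ec, mul_add]

theorem ec_sub (n : ℕ) (F G : PowerSeries A) : ec n (F - G) = ec n F - ec n G := by
  simp [ec, mul_sub]

theorem ec_C_mul (n : ℕ) (a : A) (F : PowerSeries A) :
    ec n (PowerSeries.C a * F) = a * ec n F := by
  rw [ec, PowerSeries.coeff_C_mul, ec]
  ring

theorem ec_mul (n : ℕ) (F G : PowerSeries A) :
    ec n (F * G) = ∑ m ∈ Finset.HasAntidiagonal.antidiagonal n,
      (n.choose m.1 : A) * (ec m.1 F * ec m.2 G) := by
  rw [ec, PowerSeries.coeff_mul, Finset.mul_sum]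
  refine Finset.sum_congr rfl fun m hm => ?_
  rw [Finset.HasAntidiagonal.mem_antidiagonal] at hm
  have h : n.choose m.1 * m.1.factorial * m.2.factorial = n.factorial := by
    subst hm
    rw [Nat.choose_symm_add]
    exact Nat.add_choose_mul_factorial_mul_factorial m.1 m.2
  rw [← h, ec, ec]
  push_cast
  ring

theorem ec_derivative (n : ℕ) (F : PowerSeries A) :
    ec n (PowerSeries.derivative A F) = ec (n + 1) F := by
  rw [ec, PowerSeries.coeff_derivative, ec, Nat.factorial_succ]
  push_cast
  ring

variable [Algebra ℚ A]

theorem natCast_mul_algebraMap_inv (n : ℕ) :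
    (n.factorial : A) * algebraMap ℚ A (1 / n.factorial) = 1 := by
  rw [← map_natCast (algebraMap ℚ A), ← map_mul, mul_one_div_cancel, map_one]
  exact_mod_cast n.factorial_ne_zero

theorem ext_ec {F G : PowerSeries A} (h : ∀ n, ec n F = ec n G) : F = G := by
  ext1 n
  have h1 := congrArg (algebraMap ℚ A (1 / n.factorial) * ·) (h n)
  have h2 := natCast_mul_algebraMap_inv (A := A) n
  simp only [ec] at h1
  linear_combination h1 + (PowerSeries.coeff n G - PowerSeries.coeff n F) * h2

/-- The series with prescribed exponential coefficients. -/
noncomputable def mkExp (f : ℕ → A) : PowerSeries A :=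
  PowerSeries.mk fun n => algebraMap ℚ A (1 / n.factorial) * f n

@[simp]
theorem ec_mkExp (f : ℕ → A) (n : ℕ) : ec n (mkExp f) = f n := by
  rw [ec, mkExp, PowerSeries.coeff_mk, ← mul_assoc, natCast_mul_algebraMap_inv, one_mul]

/-- The exponential series `exp (a x)`. -/
noncomputable def ex (a : A) : PowerSeries A :=
  PowerSeries.rescale a (PowerSeries.exp A)

theorem ec_ex (a : A) (n : ℕ) : ec n (ex (a : A)) = a ^ n := by
  rw [ec, ex, PowerSeries.coeff_rescale, PowerSeries.coeff_exp, mul_left_comm,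
    natCast_mul_algebraMap_inv, mul_one]

theorem ex_add (a b : A) : ex (a + b) = ex (a : A) * ex b :=
  (PowerSeries.exp_mul_exp_eq_exp_add a b).symm

theorem derivative_ex (a : A) :
    PowerSeries.derivative A (ex (a : A)) = PowerSeries.C a * ex (a : A) := by
  refine ext_ec fun n => ?_
  rw [ec_derivative, ec_C_mul, ec_ex, ec_ex, pow_succ']

theorem constantCoeff_ex (a : A) : PowerSeries.constantCoeff (ex (a : A)) = 1 := by
  rw [← ec_zero, ec_ex, pow_zero]

end Coefficients

section Gamma

variable {A : Type*} [CommRing A] {ψ : ℤ[X] →+* A}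

/-- The first coefficients of the exponential generating function `F` are `γ`-positive. -/
def GammaUpTo (ψ : ℤ[X] →+* A) (N : ℕ) (a : ℤ) (F : PowerSeries A) : Prop :=
  ∀ n < N, ∃ g ∈ gammaMonoid (n + a), ψ g = ec n F

theorem GammaUpTo.of_eq {N : ℕ} {a b : ℤ} {F : PowerSeries A} (hF : GammaUpTo ψ N a F)
    (h : a = b) : GammaUpTo ψ N b F := h ▸ hF

theorem GammaUpTo.add {N : ℕ} {a : ℤ} {F G : PowerSeries A} (hF : GammaUpTo ψ N a F)
    (hG : GammaUpTo ψ N a G) : GammaUpTo ψ N a (F + G) := by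
  intro n hn
  obtain ⟨f, hf, hf'⟩ := hF n hn
  obtain ⟨g, hg, hg'⟩ := hG n hn
  exact ⟨f + g, add_mem hf hg, by rw [map_add, hf', hg', ec_add]⟩

/-- Exponential coefficients multiply by binomial convolution, with nonnegative integer weights, and
centers add. -/
theorem GammaUpTo.mul {N : ℕ} {a b : ℤ} {F G : PowerSeries A} (hF : GammaUpTo ψ N a F)
    (hG : GammaUpTo ψ N b G) : GammaUpTo ψ N (a + b) (F * G) := by
  intro n hn
  have hF' : ∀ k, ∃ g : ℤ[X], k < N → g ∈ gammaMonoid (k + a) ∧ ψ g = ec k F := fun k => by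
    by_cases hk : k < N
    · obtain ⟨g, hg⟩ := hF k hk; exact ⟨g, fun _ => hg⟩
    · exact ⟨0, fun h => absurd h hk⟩
  have hG' : ∀ k, ∃ g : ℤ[X], k < N → g ∈ gammaMonoid (k + b) ∧ ψ g = ec k G := fun k => by
    by_cases hk : k < N
    · obtain ⟨g, hg⟩ := hG k hk; exact ⟨g, fun _ => hg⟩
    · exact ⟨0, fun h => absurd h hk⟩
  choose f hf using hF'
  choose g hg using hG'
  refine ⟨∑ m ∈ Finset.HasAntidiagonal.antidiagonal n, (n.choose m.1 : ℤ[X]) * (f m.1 * g m.2),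
    sum_mem fun m hm => ?_, ?_⟩
  · rw [Finset.HasAntidiagonal.mem_antidiagonal] at hm
    have h1 := mul_mem_gammaMonoid (hf m.1 (by omega)).1 (hg m.2 (by omega)).1
    have h2 := mul_mem_gammaMonoid (natCast_mem_gammaMonoid (n.choose m.1)) h1
    convert h2 using 2
    rw [← hm]
    push_cast
    ring
  · rw [ec_mul, map_sum]
    refine Finset.sum_congr rfl fun m hm => ?_
    rw [Finset.HasAntidiagonal.mem_antidiagonal] at hm
    rw [map_mul, map_mul, map_natCast, (hf m.1 (by omega)).2, (hg m.2 (by omega)).2]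

theorem GammaUpTo.C_mul {N : ℕ} {a b : ℤ} {F : PowerSeries A} (hF : GammaUpTo ψ N a F) {p : ℤ[X]}
    (hp : p ∈ gammaMonoid b) : GammaUpTo ψ N (b + a) (PowerSeries.C (ψ p) * F) := by
  intro n hn
  obtain ⟨f, hf, hf'⟩ := hF n hn
  refine ⟨p * f, ?_, by rw [map_mul, hf', ec_C_mul]⟩
  have := mul_mem_gammaMonoid hp hf
  convert this using 2
  ring

theorem gammaUpTo_one (ψ : ℤ[X] →+* A) (N : ℕ) : GammaUpTo ψ N 0 1 := by
  intro n _
  rcases n with _ | n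
  · exact ⟨1, by simpa using one_mem_gammaMonoid, by simp [ec_zero]⟩
  · exact ⟨0, zero_mem _, by simp [ec, PowerSeries.coeff_one]⟩

/-- Differentiation shifts exponential coefficients, so a bound `N` on the right side of a
differential equation yields `N + 1` on the solution. This drives the inductions below. -/
theorem GammaUpTo.of_derivative {N : ℕ} {a : ℤ} {F : PowerSeries A}
    (h : GammaUpTo ψ N (a + 1) (PowerSeries.derivative A F))
    (h0 : ∃ g ∈ gammaMonoid a, ψ g = PowerSeries.constantCoeff F) :
    GammaUpTo ψ (N + 1) a F := by
  intro n hn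
  rcases n with _ | n
  · rw [ec_zero]
    simpa using h0
  · obtain ⟨g, hg, hg'⟩ := h n (by omega)
    refine ⟨g, ?_, by rw [hg', ec_derivative]⟩
    convert hg using 2
    push_cast
    ring

/-- The variable `t`. -/
noncomputable def t (ψ : ℤ[X] →+* A) : PowerSeries A := PowerSeries.C (ψ X)

theorem gammaUpTo_t_mul {N : ℕ} {a : ℤ} {F : PowerSeries A} (hF : GammaUpTo ψ N a F) :
    GammaUpTo ψ N (2 + a) (t ψ * F) := by
  have := hF.C_mul X_mem_gammaMonoid
  exact this

theorem gammaUpTo_one_add_t_mul {N : ℕ} {a : ℤ} {F : PowerSeries A} (hF : GammaUpTo ψ N a F) :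
    GammaUpTo ψ N (1 + a) ((1 + t ψ) * F) := by
  have := hF.C_mul one_add_X_mem_gammaMonoid
  rwa [map_add, map_one, map_add, map_one] at this

variable (ψ)

theorem constantCoeff_t : PowerSeries.constantCoeff (t ψ) = ψ X := by simp [t]

theorem derivative_t_mul (F : PowerSeries A) :
    PowerSeries.derivative A (t ψ * F) =
      t ψ * PowerSeries.derivative A F := by
  rw [t, Derivation.leibniz, PowerSeries.derivative_C]
  simp

variable [Algebra ℚ A]

/-- The numerator `exp (a x) - exp (a t x)`. -/
noncomputable def num (ψ : ℤ[X] →+* A) (a : ℕ) : PowerSeries A := ex (a : A) - ex ((a : A) * ψ X)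

/-- The denominator `exp (a t x) - t exp (a x)`. -/
noncomputable def den (ψ : ℤ[X] →+* A) (a : ℕ) : PowerSeries A :=
  ex ((a : A) * ψ X) - t ψ * ex (a : A)

theorem constantCoeff_den (a : ℕ) :
    PowerSeries.constantCoeff (den ψ a) = 1 - ψ X := by
  simp [den, constantCoeff_ex, constantCoeff_t]

theorem constantCoeff_num (a : ℕ) : PowerSeries.constantCoeff (num ψ a) = 0 := by
  simp [num, constantCoeff_ex]

theorem derivative_num (a : ℕ) :
    PowerSeries.derivative A (num ψ a) =
      (a : PowerSeries A) * (ex (a : A) - t ψ * ex ((a : A) * ψ X)) := by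
  rw [num, map_sub, derivative_ex, derivative_ex, map_mul, map_natCast, t]
  ring

theorem derivative_den (a : ℕ) :
    PowerSeries.derivative A (den ψ a) = -(a * t ψ * num ψ a) := by
  rw [den, map_sub, derivative_t_mul, derivative_ex, derivative_ex, map_mul, map_natCast, num, t]
  ring

variable [hψ : Fact (IsUnit (1 - ψ X))]

theorem isUnit_den (a : ℕ) : IsUnit (den ψ a) := by
  rw [PowerSeries.isUnit_iff_constantCoeff, constantCoeff_den]
  exact hψ.out

/-- The exponential generating function of `a ^ n A_n(t)`, `n ≥ 1`, for the Eulerian polynomials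
`A_n(t)`. -/
noncomputable def eul (ψ : ℤ[X] →+* A) (a : ℕ) : PowerSeries A := num ψ a * Ring.inverse (den ψ a)

theorem eul_mul_den (a : ℕ) : eul ψ a * den ψ a = num ψ a := by
  rw [eul, mul_assoc, Ring.inverse_mul_cancel _ (isUnit_den ψ a), mul_one]

/-- The quotient rule yields a Riccati equation with coefficients `1`, `1 + t` and `t`, all
`γ`-positive, and of weights that match when the series itself has weight `-1`. -/
theorem derivative_eul (a : ℕ) :
    PowerSeries.derivative A (eul ψ a) =
      (a : PowerSeries A) * (1 + (1 + t ψ) * eul ψ a + t ψ * (eul ψ a * eul ψ a)) := by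
  apply (isUnit_den ψ a).mul_right_cancel
  have h := congrArg (PowerSeries.derivative A) (eul_mul_den ψ a)
  rw [Derivation.leibniz, derivative_den, derivative_num, smul_eq_mul, smul_eq_mul] at h
  have h2 := eul_mul_den ψ a
  have h3 : den ψ a = ex ((a : A) * ψ X) - t ψ * ex (a : A) := rfl
  have h4 : num ψ a = ex (a : A) - ex ((a : A) * ψ X) := rfl
  linear_combination h - (a : PowerSeries A) * ((1 + t ψ) + t ψ * eul ψ a) * h2 - a * h3 -
    (a : PowerSeries A) * (1 + t ψ) * h4

theorem constantCoeff_eul (a : ℕ) : PowerSeries.constantCoeff (eul ψ a) = 0 := by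
  have h := congrArg PowerSeries.constantCoeff (eul_mul_den ψ a)
  rw [map_mul, constantCoeff_den, constantCoeff_num] at h
  exact hψ.out.mul_right_cancel (h.trans (zero_mul _).symm)

theorem gammaUpTo_eul (a : ℕ) (N : ℕ) : GammaUpTo ψ N (-1) (eul ψ a) := by
  induction N with
  | zero => intro n hn; omega
  | succ N ih =>
    refine GammaUpTo.of_derivative ?_ ⟨0, zero_mem _, by rw [map_zero, constantCoeff_eul]⟩
    rw [derivative_eul]
    have h1 : GammaUpTo ψ N 0 ((1 + t ψ) * eul ψ a) :=
      (gammaUpTo_one_add_t_mul ih).of_eq (by norm_num)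
    have h2 : GammaUpTo ψ N 0 (t ψ * (eul ψ a * eul ψ a)) :=
      (gammaUpTo_t_mul (ih.mul ih)).of_eq (by norm_num)
    have h3 := (((gammaUpTo_one ψ N).add h1).add h2).C_mul (natCast_mem_gammaMonoid a)
    rw [map_natCast, map_natCast] at h3
    exact h3.of_eq (by norm_num)

/-- The exponential generating function of the binomial Eulerian polynomials. -/
noncomputable def binEul (ψ : ℤ[X] →+* A) : PowerSeries A :=
  (1 - t ψ) * ex (1 + ψ X) * Ring.inverse (den ψ 1)

theorem binEul_mul_den : binEul ψ * den ψ 1 = (1 - t ψ) * ex (1 + ψ X) := by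
  rw [binEul, mul_assoc, Ring.inverse_mul_cancel _ (isUnit_den ψ 1), mul_one]

theorem derivative_binEul :
    PowerSeries.derivative A (binEul ψ) =
      (1 + t ψ) * binEul ψ + t ψ * (eul ψ 1 * binEul ψ) := by
  apply (isUnit_den ψ 1).mul_right_cancel
  have h := congrArg (PowerSeries.derivative A) (binEul_mul_den ψ)
  have h1 : PowerSeries.derivative A ((1 - t ψ) * ex (1 + ψ X)) =
      (1 + t ψ) * ((1 - t ψ) * ex (1 + ψ X)) := by
    rw [sub_mul, one_mul, map_sub, derivative_t_mul, derivative_ex, map_add, map_one]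
    change (1 + t ψ) * _ - t ψ * ((1 + t ψ) * _) = _
    ring
  rw [h1, Derivation.leibniz, derivative_den, smul_eq_mul, smul_eq_mul] at h
  have h2 := eul_mul_den ψ 1
  have h3 := binEul_mul_den ψ
  push_cast at h
  linear_combination h - t ψ * binEul ψ * h2 - (1 + t ψ) * h3

theorem constantCoeff_binEul : PowerSeries.constantCoeff (binEul ψ) = 1 := by
  have h := congrArg PowerSeries.constantCoeff (binEul_mul_den ψ)
  rw [map_mul, map_mul, map_sub, constantCoeff_den, constantCoeff_ex, constantCoeff_t, map_one,
    mul_one] at h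
  exact hψ.out.mul_right_cancel (h.trans (one_mul _).symm)

theorem gammaUpTo_binEul (N : ℕ) : GammaUpTo ψ N 0 (binEul ψ) := by
  induction N with
  | zero => intro n hn; omega
  | succ N ih =>
    refine GammaUpTo.of_derivative ?_ ⟨1, one_mem_gammaMonoid, by
      rw [map_one, constantCoeff_binEul]⟩
    rw [derivative_binEul]
    have h1 : GammaUpTo ψ N 1 ((1 + t ψ) * binEul ψ) :=
      (gammaUpTo_one_add_t_mul ih).of_eq (by norm_num)
    have h2 : GammaUpTo ψ N 1 (t ψ * (eul ψ 1 * binEul ψ)) :=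
      (gammaUpTo_t_mul ((gammaUpTo_eul ψ 1 N).mul ih)).of_eq (by norm_num)
    exact (h1.add h2).of_eq (by norm_num)

/-- The geometric series `1 / (1 - t T_1 T_s)` in the generating functions `T_a`. -/
noncomputable def geom (ψ : ℤ[X] →+* A) (s : ℕ) : PowerSeries A :=
  Ring.inverse (1 - t ψ * (eul ψ 1 * eul ψ s))

theorem geom_mul (s : ℕ) : geom ψ s * (1 - t ψ * (eul ψ 1 * eul ψ s)) = 1 := by
  refine Ring.inverse_mul_cancel _ ?_
  rw [PowerSeries.isUnit_iff_constantCoeff]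
  simp [constantCoeff_eul]

theorem derivative_geom (s : ℕ) :
    PowerSeries.derivative A (geom ψ s) =
      geom ψ s * geom ψ s * (t ψ * (PowerSeries.derivative A (eul ψ 1) * eul ψ s +
        eul ψ 1 * PowerSeries.derivative A (eul ψ s))) := by
  have h := congrArg (PowerSeries.derivative A) (geom_mul ψ s)
  rw [Derivation.leibniz, map_sub, derivative_t_mul, Derivation.leibniz,
    Derivation.map_one_eq_zero, zero_sub, smul_eq_mul, smul_eq_mul, smul_eq_mul, smul_eq_mul] at h
  have h2 := geom_mul ψ s
  linear_combination geom ψ s * h - PowerSeries.derivative A (geom ψ s) * h2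

theorem gammaUpTo_geom (s N : ℕ) : GammaUpTo ψ N 0 (geom ψ s) := by
  induction N with
  | zero => intro n hn; omega
  | succ N ih =>
    have hc : PowerSeries.constantCoeff (geom ψ s) = 1 := by
      have h := congrArg PowerSeries.constantCoeff (geom_mul ψ s)
      simpa [constantCoeff_eul] using h
    refine GammaUpTo.of_derivative ?_ ⟨1, one_mem_gammaMonoid, by rw [map_one, hc]⟩
    have hder : ∀ a, GammaUpTo ψ N 0 (PowerSeries.derivative A (eul ψ a)) := by
      intro a n hn
      obtain ⟨g, hg, hg'⟩ := gammaUpTo_eul ψ a (N + 1) (n + 1) (by omega)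
      refine ⟨g, ?_, by rw [hg', ec_derivative]⟩
      convert hg using 2
      push_cast
      ring
    rw [derivative_geom]
    have h1 := (((hder 1).mul (gammaUpTo_eul ψ s N)).of_eq (zero_add (-1))).add
      (((gammaUpTo_eul ψ 1 N).mul (hder s)).of_eq (add_zero (-1)))
    exact ((ih.mul ih).mul (gammaUpTo_t_mul h1)).of_eq (by norm_num)

/-- The exponential generating function of the palindromic part with center `n / 2`. -/
noncomputable def plusPart (ψ : ℤ[X] →+* A) (s : ℕ) : PowerSeries A := binEul ψ * geom ψ s

/-- The generating function of the palindromic part with center `(n + 1) / 2`, divided by `t`. -/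
noncomputable def minusPart (ψ : ℤ[X] →+* A) (s : ℕ) : PowerSeries A := eul ψ s * plusPart ψ s

theorem gammaUpTo_plusPart (s N : ℕ) : GammaUpTo ψ N 0 (plusPart ψ s) :=
  ((gammaUpTo_binEul ψ N).mul (gammaUpTo_geom ψ s N)).of_eq (by norm_num)

theorem gammaUpTo_minusPart (s N : ℕ) : GammaUpTo ψ N (-1) (minusPart ψ s) :=
  ((gammaUpTo_eul ψ s N).mul (gammaUpTo_plusPart ψ s N)).of_eq (by norm_num)

/-- The addition formula `den 1 * den s - t * num 1 * num s = (1 - t) * den (s + 1)` turns the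
geometric series in `T_1 T_s` into a quotient with denominator `den (s + 1)`. -/
theorem den_mul_plusPart (s : ℕ) :
    den ψ (s + 1) * plusPart ψ s = ex (1 : A) * ex (ψ X) * den ψ s := by
  have hu : IsUnit (1 - t ψ) := by
    rw [PowerSeries.isUnit_iff_constantCoeff, map_sub, constantCoeff_t, map_one]
    exact hψ.out
  apply hu.mul_left_cancel
  have h1 := eul_mul_den ψ 1
  have h2 := eul_mul_den ψ s
  have h3 := binEul_mul_den ψ
  have h4 := geom_mul ψ s
  have e : (((s + 1 : ℕ) : A)) = (s : A) + 1 := by push_cast; rfl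
  have d1 : den ψ 1 = ex (ψ X) - t ψ * ex (1 : A) := by simp [den]
  have n1 : num ψ 1 = ex (1 : A) - ex (ψ X) := by simp [num]
  have ds : den ψ s = ex ((s : A) * ψ X) - t ψ * ex (s : A) := rfl
  have ns : num ψ s = ex (s : A) - ex ((s : A) * ψ X) := rfl
  have dss : den ψ (s + 1) = ex ((s : A) * ψ X) * ex (ψ X) - t ψ * (ex (s : A) * ex (1 : A)) := by
    rw [den, e, ex_add, add_mul, one_mul, ex_add]
  have key : den ψ 1 * den ψ s - t ψ * (num ψ 1 * num ψ s) = (1 - t ψ) * den ψ (s + 1) := by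
    rw [d1, n1, ds, ns, dss]
    ring
  have key2 : (1 - t ψ) * den ψ (s + 1) = den ψ 1 * den ψ s * (1 - t ψ * (eul ψ 1 * eul ψ s)) := by
    rw [← key, ← h1, ← h2]
    ring
  rw [ex_add] at h3
  rw [← mul_assoc, key2, plusPart]
  linear_combination den ψ 1 * den ψ s * binEul ψ * h4 + den ψ s * h3

/-- Since `den s + t * num s = (1 - t) * e^{s t x}`, the factor `1 + t T_s` replaces `den s` by a
single exponential. -/
theorem den_mul_total (s : ℕ) :
    den ψ (s + 1) * (plusPart ψ s + t ψ * minusPart ψ s) =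
      (1 - t ψ) * (ex (1 : A) * ex (((s + 1 : ℕ) : A) * ψ X)) := by
  have h := den_mul_plusPart ψ s
  have h2 := eul_mul_den ψ s
  have ds : den ψ s = ex ((s : A) * ψ X) - t ψ * ex (s : A) := rfl
  have ns : num ψ s = ex (s : A) - ex ((s : A) * ψ X) := rfl
  have e : ex (((s + 1 : ℕ) : A) * ψ X) = ex ((s : A) * ψ X) * ex (ψ X) := by
    push_cast
    rw [add_mul, one_mul, ex_add]
  rw [minusPart, e]
  linear_combination (1 + t ψ * eul ψ s) * h + ex (1 : A) * ex (ψ X) * (t ψ * h2 + ds + t ψ * ns)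

end Gamma

end ExpGenFun

/-! ### Identification of the polytope and Eulerian generating functions. -/

namespace ExpGenFun

instance : Fact (IsUnit (1 - toSeries X)) where
  out := by
    rw [toSeries_X, PowerSeries.isUnit_iff_constantCoeff]
    simp

/-- The double generating function of the powers `(b + j * c) ^ n`. -/
noncomputable def powSum (b c : PowerSeries ℚ) : PowerSeries (PowerSeries ℚ) :=
  mkExp fun n => PowerSeries.shiftSum fun j => (b + (j : PowerSeries ℚ) * c) ^ n

/-- This is the geometric series `∑_j t^j e^{(b + j c) x}`: split off `j = 0` and take out `t e^{c
x}`. -/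
theorem powSum_eq (b c : PowerSeries ℚ) :
    powSum b c = ex b + t toSeries * (ex c * powSum b c) := by
  refine ext_ec fun n => ?_
  rw [ec_add, t, ec_C_mul, ec_mul, ec_ex, powSum, ec_mkExp, PowerSeries.shiftSum_eq, toSeries_X]
  congr 2
  · simp
  have h : (fun j : ℕ => (b + ((j + 1 : ℕ) : PowerSeries ℚ) * c) ^ n) = fun j : ℕ =>
      ∑ m ∈ Finset.HasAntidiagonal.antidiagonal n,
        (n.choose m.1 : PowerSeries ℚ) * c ^ m.1 * (b + ((j : ℕ) : PowerSeries ℚ) * c) ^ m.2 := by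
    ext1 j
    rw [show b + ((j + 1 : ℕ) : PowerSeries ℚ) * c = c + (b + (j : PowerSeries ℚ) * c) by
      push_cast; ring, (Commute.all _ _).add_pow']
    refine Finset.sum_congr rfl fun m _ => ?_
    rw [nsmul_eq_mul, mul_assoc]
  rw [h, PowerSeries.shiftSum_sum]
  refine Finset.sum_congr rfl fun m _ => ?_
  rw [PowerSeries.shiftSum_mul_left, ec_mkExp, ec_ex, mul_assoc]

variable (r : ℕ)

/-- The generating function of the `h`-polynomials of the boundary complexes. -/
noncomputable def polytopeSeries : PowerSeries (PowerSeries ℚ) :=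
  mkExp fun n => PowerSeries.X ^ n + PowerSeries.shiftSum (CubePoint.powDiff n r)

theorem polytopeSeries_eq : polytopeSeries r = ex PowerSeries.X +
    powSum 1 ((r : PowerSeries ℚ) * (1 - PowerSeries.X)) -
    powSum PowerSeries.X ((r : PowerSeries ℚ) * (1 - PowerSeries.X)) := by
  refine ext_ec fun n => ?_
  rw [ec_sub, ec_add, ec_ex, powSum, powSum, polytopeSeries, ec_mkExp, ec_mkExp, ec_mkExp,
    add_sub_assoc, ← PowerSeries.shiftSum_sub]
  congr 2
  ext1 j
  rw [CubePoint.powDiff, mul_assoc]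

theorem den_eq (ρ : PowerSeries ℚ) (hρ : ρ = (r : PowerSeries ℚ)) :
    den toSeries r = ex (ρ * PowerSeries.X) *
      (1 - t toSeries * ex (ρ * (1 - PowerSeries.X))) := by
  have h : ex ρ = ex (ρ * PowerSeries.X) * ex (ρ * (1 - PowerSeries.X)) := by
    rw [← ex_add]
    congr 1
    ring
  rw [den, toSeries_X, ← hρ, h]
  ring

/-- By `den_eq`, multiplication by `den (s + 1)` clears the geometric series on the left, leaving a
product of exponentials to compare. -/
theorem polytopeSeries_eq_plusPart (s : ℕ) :
    polytopeSeries (s + 1) = plusPart toSeries s := by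
  apply (isUnit_den toSeries (s + 1)).mul_left_cancel
  rw [den_mul_plusPart, den_eq (s + 1) _ rfl, polytopeSeries_eq]
  generalize hρ : ((s + 1 : ℕ) : PowerSeries ℚ) = ρ
  have hs : (s : PowerSeries ℚ) = ρ - 1 := by rw [← hρ]; push_cast; ring
  have h1 := powSum_eq 1 (ρ * (1 - PowerSeries.X))
  have h2 := powSum_eq PowerSeries.X (ρ * (1 - PowerSeries.X))
  have h3 : ex (ρ * PowerSeries.X) = ex PowerSeries.X * ex ((ρ - 1) * PowerSeries.X) := by
    rw [← ex_add]
    congr 1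
    ring
  have h4 : ex (ρ * PowerSeries.X) * ex (ρ * (1 - PowerSeries.X)) = ex 1 * ex (ρ - 1) := by
    rw [← ex_add, ← ex_add]
    congr 1
    ring
  rw [den, toSeries_X, hs]
  linear_combination ex (ρ * PowerSeries.X) * h1 - ex (ρ * PowerSeries.X) * h2 + ex 1 * h3
    - t toSeries * ex PowerSeries.X * h4

/-- The generating function of the colored Eulerian polynomials. -/
noncomputable def eulerianSeries : PowerSeries (PowerSeries ℚ) :=
  mkExp fun n => toSeries (coloredEulerian n r)

/-- In the Carlitz identity, `n` of the factors `1 - t` are absorbed into the `n`-th power and one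
stays outside. -/
theorem eulerianSeries_eq (hr : 0 < r) : eulerianSeries r = (1 - t toSeries) *
    powSum (1 - PowerSeries.X) ((r : PowerSeries ℚ) * (1 - PowerSeries.X)) := by
  have ht : (1 : PowerSeries (PowerSeries ℚ)) - t toSeries =
      PowerSeries.C (1 - PowerSeries.X) := by
    rw [t, toSeries_X, map_sub, map_one]
  refine ext_ec fun n => ?_
  rw [ht, ec_C_mul, eulerianSeries, powSum, ec_mkExp, ec_mkExp, toSeries_coloredEulerian n r hr,
    pow_succ', mul_assoc]
  congr 1
  have h := PowerSeries.shiftSum_natCast (R := ℚ) fun j => (r * j + 1) ^ n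
  push_cast at h
  push_cast
  rw [← h, ← PowerSeries.shiftSum_mul_left]
  congr 1
  ext1 j
  rw [← mul_pow]
  congr 1
  ring

/-- The generating function of the colored binomial Eulerian polynomials. -/
noncomputable def binomialEulerianSeries : PowerSeries (PowerSeries ℚ) :=
  mkExp fun n => toSeries (coloredBinomialEulerian n r)

theorem binomialEulerianSeries_eq :
    binomialEulerianSeries r = eulerianSeries r * ex PowerSeries.X := by
  refine ext_ec fun n => ?_
  rw [ec_mul, binomialEulerianSeries, ec_mkExp, coloredBinomialEulerian, map_sum,
    Finset.Nat.sum_antidiagonal_eq_sum_range_succ_mk]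
  refine Finset.sum_congr rfl fun m _ => ?_
  rw [eulerianSeries, ec_mkExp, ec_ex, map_mul, map_mul, map_natCast, map_pow, toSeries_X]
  ring

theorem binomialEulerianSeries_eq_add (s : ℕ) : binomialEulerianSeries (s + 1) =
    plusPart toSeries s + t toSeries * minusPart toSeries s := by
  apply (isUnit_den toSeries (s + 1)).mul_left_cancel
  rw [den_mul_total, den_eq (s + 1) _ rfl, binomialEulerianSeries_eq,
    eulerianSeries_eq _ s.succ_pos, toSeries_X]
  generalize ((s + 1 : ℕ) : PowerSeries ℚ) = ρ
  have h1 := powSum_eq (1 - PowerSeries.X) (ρ * (1 - PowerSeries.X))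
  have h2 : ex (1 - PowerSeries.X) * ex PowerSeries.X = ex (1 : PowerSeries ℚ) := by
    rw [← ex_add, sub_add_cancel]
  linear_combination (1 - t toSeries) * ex (ρ * PowerSeries.X) * ex PowerSeries.X * h1
    + (1 - t toSeries) * ex (ρ * PowerSeries.X) * h2

end ExpGenFun

/-! ### Palindromicity, uniqueness and the final decomposition. -/

/-- A polynomial of degree at most `c` with `coeff f i = coeff f (c - i)`. -/
structure IsPalindromic (c : ℕ) (f : ℤ[X]) : Prop where
  natDegree_le : f.natDegree ≤ c
  reflect_eq : f.reflect c = f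

namespace IsPalindromic

theorem add {c : ℕ} {f g : ℤ[X]} (hf : IsPalindromic c f) (hg : IsPalindromic c g) :
    IsPalindromic c (f + g) :=
  ⟨natDegree_add_le_of_degree_le hf.1 hg.1, by rw [reflect_add, hf.2, hg.2]⟩

theorem neg {c : ℕ} {f : ℤ[X]} (hf : IsPalindromic c f) : IsPalindromic c (-f) :=
  ⟨by rw [natDegree_neg]; exact hf.1, by rw [reflect_neg, hf.2]⟩

theorem mul {c d : ℕ} {f g : ℤ[X]} (hf : IsPalindromic c f) (hg : IsPalindromic d g) :
    IsPalindromic (c + d) (f * g) :=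
  ⟨natDegree_mul_le_of_le hf.1 hg.1, by rw [reflect_mul f g hf.1 hg.1, hf.2, hg.2]⟩

theorem natCast (m : ℕ) : IsPalindromic 0 (m : ℤ[X]) := by
  refine ⟨by simp, ?_⟩
  rw [← C_eq_natCast, reflect_C, pow_zero, mul_one]

theorem pow {c : ℕ} {f : ℤ[X]} (hf : IsPalindromic c f) (k : ℕ) :
    IsPalindromic (c * k) (f ^ k) := by
  induction k with
  | zero => simpa using natCast 1
  | succ k ih => rw [pow_succ]; exact ih.mul hf

theorem X : IsPalindromic 2 (Polynomial.X : ℤ[X]) := by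
  refine ⟨by simp, ?_⟩
  have := reflect_monomial (R := ℤ) 2 1
  simpa [revAt_le one_le_two] using this

theorem one_add_X : IsPalindromic 1 (1 + Polynomial.X : ℤ[X]) := by
  refine ⟨natDegree_add_le_of_degree_le (by simp) (by simp), ?_⟩
  have h0 := reflect_monomial (R := ℤ) 1 0
  have h1 := reflect_monomial (R := ℤ) 1 1
  rw [revAt_le zero_le_one, pow_zero, Nat.sub_zero, pow_one] at h0
  rw [revAt_le le_rfl, pow_one, pow_zero] at h1
  rw [reflect_add, h0, h1, add_comm]

/-- A polynomial that is palindromic with two consecutive centers vanishes. -/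
theorem eq_zero {c : ℕ} {f : ℤ[X]} (h : IsPalindromic c f) (h' : IsPalindromic (c + 1) f) :
    f = 0 := by
  -- Two reflections about consecutive centers compose to a shift by one, so the coefficients are
  -- constant up to index `c + 1`, where the degree bound gives zero.
  have h1 : ∀ i ≤ c, f.coeff i = f.coeff (i + 1) := by
    intro i hi
    have e := congrArg (fun g => coeff g i) h.reflect_eq
    have e' := congrArg (fun g => coeff g (i + 1)) h'.reflect_eq
    simp only [coeff_reflect] at e e'
    rw [revAt_le hi] at e
    rw [revAt_le (by omega), Nat.add_sub_add_right] at e'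
    rw [← e, ← e']
  have h2 : ∀ k i, c + 1 ≤ i + k → f.coeff i = 0 := by
    intro k
    induction k with
    | zero =>
      intro i hi
      exact coeff_eq_zero_of_natDegree_lt (by have := h.natDegree_le; omega)
    | succ k ih =>
      intro i hi
      by_cases hic : i ≤ c
      · rw [h1 i hic]
        exact ih _ (by omega)
      · exact ih _ (by omega)
  ext i
  exact h2 (c + 1) i (by omega)

end IsPalindromic

theorem IsGammaPositive.isPalindromic {c : ℕ} {f : ℤ[X]} (hf : IsGammaPositive c f) :
    IsPalindromic c f := by
  obtain ⟨γ, rfl⟩ := hf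
  refine Finset.sum_induction _ (IsPalindromic c) (fun _ _ => IsPalindromic.add)
    (by simpa using (IsPalindromic.natCast 0).mul (IsPalindromic.one_add_X.pow c)) fun i hi => ?_
  have h := ((IsPalindromic.natCast (γ i)).mul (IsPalindromic.X.pow i)).mul
    (IsPalindromic.one_add_X.pow (c - 2 * i))
  have hc : 0 + 2 * i + 1 * (c - 2 * i) = c := by
    have := Finset.mem_range.1 hi
    omega
  rwa [hc] at h

/-- The polynomial `p - p' = q' - q` is palindromic for both `n` and `n + 1`. -/
theorem IsGammaDecomposition.unique {n : ℕ} {f p q p' q' : ℤ[X]}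
    (h : IsGammaDecomposition n f p q) (h' : IsGammaDecomposition n f p' q') :
    p = p' ∧ q = q' := by
  have e : p + -p' = q' + -q := by linear_combination h'.sum_eq - h.sum_eq
  have h0 : p + -p' = 0 := (h.left.isPalindromic.add h'.left.isPalindromic.neg).eq_zero
    (e ▸ h'.right.isPalindromic.add h.right.isPalindromic.neg)
  exact ⟨by linear_combination h0, by linear_combination e - h0⟩

open ExpGenFun in
theorem exists_isGammaDecomposition (n s : ℕ) : ∃ p q : ℤ[X],
    IsGammaDecomposition n (coloredBinomialEulerian n (s + 1)) p q ∧
      toSeries p = PowerSeries.X ^ n + PowerSeries.shiftSum (CubePoint.powDiff n (s + 1)) := by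
  obtain ⟨p, hp, hp'⟩ := gammaUpTo_plusPart toSeries s (n + 1) n n.lt_succ_self
  obtain ⟨q, hq, hq'⟩ := gammaUpTo_minusPart toSeries s (n + 1) n n.lt_succ_self
  rw [add_zero] at hp
  refine ⟨p, X * q, ⟨toSeries_injective ?_, isGammaPositive_of_mem hp, ?_, by simp⟩, ?_⟩
  · have h := congrArg (ec n) (binomialEulerianSeries_eq_add s)
    rw [binomialEulerianSeries, ec_mkExp, ec_add, t, ec_C_mul, ← hp', ← hq'] at h
    rw [h, map_add, map_mul]
  · refine isGammaPositive_of_mem ?_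
    -- The factor `X` moves the weight from `n - 1` to `n + 1`; it also kills the constant term.
    convert mul_mem_gammaMonoid X_mem_gammaMonoid hq using 2
    push_cast
    ring
  · rw [hp', ← polytopeSeries_eq_plusPart, polytopeSeries, ec_mkExp]

theorem theorem1p2 (n r : ℕ) (hn : 1 ≤ n) (hr : 2 ≤ r) :
    ∃ Aplus Aminus : ℤ[X],
      IsGammaDecomposition n (coloredBinomialEulerian n r) Aplus Aminus ∧
      (∀ p q : ℤ[X], IsGammaDecomposition n (coloredBinomialEulerian n r) p q →
        p = Aplus ∧ q = Aminus) ∧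
      ∃ P : Set (EuclideanSpace ℝ (Fin n)),
        IsSimplicialPolytope n P ∧ (boundaryComplex P).IsFlag ∧
        (boundaryComplex P).hPolynomial n = Aplus := by
  obtain ⟨s, rfl⟩ : ∃ s, r = s + 1 := ⟨r - 1, by omega⟩
  obtain ⟨p, q, h, hp⟩ := exists_isGammaDecomposition n s
  obtain ⟨P, hP, hflag, hh⟩ := CubePoint.exists_polytope (n := n) (r := s + 1) hn s.succ_pos
  exact ⟨p, q, h, fun _ _ h' => h'.unique h, P, hP, hflag,
    toSeries_injective (hh.trans hp.symm)⟩
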